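/- Let every Hilbert space be a finite tensor product of spaces $\mathcal H_d$ of odd prime dimension $d$ with computational basis $\{|j\rangle\}_{j\in\mathbb Z_d}$. On $\mathcal H_d$ let $X|j\rangle=|j\oplus 1\rangle$, $Z|j\rangle=e^{2\pi i j/d}|j\rangle$, and $T_{(a_1,a_2)}=\tau_d^{-a_1a_2}Z^{a_1}X^{a_2}$ with $\tau_d=e^{(d+1)\pi i/d}$ and $(a_1,a_2)\in\mathbb Z_d\times\mathbb Z_d$; on a tensor product the operators $T_{\mathbf u}$ are the tensor products of those of the factors. For a space of total dimension $D$ let $A_0=\frac1D\sum_{\mathbf u}T_{\mathbf u}$, $A_{\mathbf u}=T_{\mathbf u}A_0T_{\mathbf u}^\dagger$, $W_V(\mathbf u)=\frac1D\operatorname{tr}(A_{\mathbf u}V)$, $\|V\|_{W,1}=\sum_{\mathbf u}|W_V(\mathbf u)|$, and let $$\mathcal W=\{\sigma\ge 0:\ \log_2\|\sigma\|_{W,1}\le 0\}$$ (with $\log_2 0=-\infty$). For a state $\rho$ (a positive semi-definite operator of trace one), with $P_\rho$ the projection onto its support, define $$\theta_{\min}(\rho)=\inf_{\sigma\in\mathcal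 W}\bigl[-\log_2\operatorname{tr}(P_\rho\sigma)\bigr],\qquad \theta_{\max}(\rho)=\inf_{\sigma\in\mathcal W}\inf\{\lambda\in\mathbb R:\rho\le 2^\lambda\sigma\},\qquad \theta(\rho)=\inf_{\sigma\in\mathcal W}D(\rho\|\sigma),$$ where $D(\rho\|\sigma)=\operatorname{tr}[\rho(\log_2\rho-\log_2\sigma)]$ if $\operatorname{supp}\rho\subseteq\operatorname{supp}\sigma$ and $D(\rho\|\sigma)=+\infty$ otherwise (also $-\log_2 0=+\infty$ and $\inf\emptyset=+\infty$). Then for all states $\rho$ and $\tau$ (possibly on different spaces) $$\theta_{\min}(\rho\otimes\tau)=\theta_{\min}(\rho)+\theta_{\min}(\tau),\qquad \theta_{\max}(\rho\otimes\tau)=\theta_{\max}(\rho)+\theta_{\max}(\tau).$$ Consequently, for every state $\rho$ the limit $\theta^\infty(\rho)=\lim_{n\to\infty}\frac1n\theta(\rho^{\otimes n})$ exists and $$\theta_{\min}(\rho)\le\theta^\infty(\rho)\le\theta_{\max}(\rho).$$ -/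

import Mathlib

open Filter Topology
open scoped Kronecker ComplexOrder

/-- A finite-dimensional quantum system of odd dimension, presented as a (bracketed) tensor product
of systems of odd prime dimension. `unit` is the empty tensor product, of dimension one. -/
inductive QSystem : Type
  | unit : QSystem
  | qudit (d : ℕ) (prime : d.Prime) (odd : Odd d) : QSystem
  | tensor (A B : QSystem) : QSystem

namespace QSystem

/-- Labels of the computational basis of the Hilbert space of the system. -/
def Idx : QSystem → Type
  | unit => Unit
  | qudit d _ _ => ZMod d
  | tensor A B => Idx A × Idx B

/-- Discrete phase space: `ℤ_d × ℤ_d` for a qudit, and the product for a composite system. -/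
def Phase : QSystem → Type
  | unit => Unit
  | qudit d _ _ => ZMod d × ZMod d
  | tensor A B => Phase A × Phase B

instance instFintypeIdx : (S : QSystem) → Fintype S.Idx
  | unit => inferInstanceAs (Fintype Unit)
  | qudit d hd _ => haveI : NeZero d := ⟨hd.ne_zero⟩; inferInstanceAs (Fintype (ZMod d))
  | tensor A B =>
      haveI := instFintypeIdx A
      haveI := instFintypeIdx B
      inferInstanceAs (Fintype (Idx A × Idx B))

instance instDecidableEqIdx : (S : QSystem) → DecidableEq S.Idx
  | unit => inferInstanceAs (DecidableEq Unit)
  | qudit d _ _ => inferInstanceAs (DecidableEq (ZMod d))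
  | tensor A B =>
      haveI := instDecidableEqIdx A
      haveI := instDecidableEqIdx B
      inferInstanceAs (DecidableEq (Idx A × Idx B))

instance instFintypePhase : (S : QSystem) → Fintype S.Phase
  | unit => inferInstanceAs (Fintype Unit)
  | qudit d hd _ => haveI : NeZero d := ⟨hd.ne_zero⟩; inferInstanceAs (Fintype (ZMod d × ZMod d))
  | tensor A B =>
      haveI := instFintypePhase A
      haveI := instFintypePhase B
      inferInstanceAs (Fintype (Phase A × Phase B))

/-- Dimension of the Hilbert space. -/
def dim (S : QSystem) : ℕ := Fintype.card S.Idx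

/-- Linear operators on the Hilbert space, as matrices in the computational basis. -/
abbrev Op (S : QSystem) : Type := Matrix S.Idx S.Idx ℂ

/-- The tensor product of `n` copies of a system. -/
def pow (S : QSystem) : ℕ → QSystem
  | 0 => unit
  | n + 1 => tensor (pow S n) S

end QSystem

/-- Tensor product of operators. -/
def tensorOp {A B : QSystem} (ρ : A.Op) (τ : B.Op) : (A.tensor B).Op :=
  (ρ ⊗ₖ τ : Matrix (A.Idx × B.Idx) (A.Idx × B.Idx) ℂ)

/-- The `n`-fold tensor power of an operator. -/
def tensorPow {S : QSystem} (ρ : S.Op) : (n : ℕ) → (S.pow n).Op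
  | 0 => (1 : QSystem.unit.Op)
  | n + 1 => tensorOp (tensorPow ρ n) ρ

/-- Quantum states: positive semi-definite operators of trace one. -/
def IsState {S : QSystem} (ρ : S.Op) : Prop := ρ.PosSemidef ∧ ρ.trace = 1

/-- The shift operator `X|j⟩ = |j ⊕ 1⟩`. -/
def shiftOp (d : ℕ) : Matrix (ZMod d) (ZMod d) ℂ :=
  Matrix.of fun i j => if i = j + 1 then 1 else 0

/-- The boost operator `Z|j⟩ = ω ^ j |j⟩` with `ω = exp (2πi/d)`. -/
noncomputable def boostOp (d : ℕ) : Matrix (ZMod d) (ZMod d) ℂ :=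
  Matrix.diagonal fun j => Complex.exp (2 * Real.pi * Complex.I / d) ^ j.val

/-- The Heisenberg-Weyl operators: `τ ^ (-a₁a₂) Z ^ a₁ X ^ a₂` with `τ = exp ((d+1)πi/d)` for a
qudit, and tensor products of those of the subsystems for a composite system. -/
noncomputable def weyl : (S : QSystem) → S.Phase → S.Op
  | .unit, _ => (1 : Matrix Unit Unit ℂ)
  | .qudit d hd _, a =>
      haveI : NeZero d := ⟨hd.ne_zero⟩
      let a₁ : ℕ := ZMod.val (Prod.fst (α := ZMod d) (β := ZMod d) a)
      let a₂ : ℕ := ZMod.val (Prod.snd (α := ZMod d) (β := ZMod d) a)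
      (Complex.exp ((d + 1) * Real.pi * Complex.I / d) ^ (-((a₁ : ℤ) * (a₂ : ℤ))) •
        (boostOp d ^ a₁ * shiftOp d ^ a₂) : Matrix (ZMod d) (ZMod d) ℂ)
  | .tensor A B, u => tensorOp (weyl A (Prod.fst (α := A.Phase) (β := B.Phase) u))
      (weyl B (Prod.snd (α := A.Phase) (β := B.Phase) u))

/-- The phase-space point operator at the origin, `A₀ = (1/d) ∑ u, T_u`. -/
noncomputable def pointOpZero (S : QSystem) : S.Op :=
  (S.dim : ℂ)⁻¹ • ∑ u : S.Phase, weyl S u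

/-- The phase-space point operators `A_u = T_u A₀ T_u†`. -/
noncomputable def pointOp (S : QSystem) (u : S.Phase) : S.Op :=
  weyl S u * pointOpZero S * (weyl S u).conjTranspose

/-- The discrete Wigner function `W_V(u) = tr (A_u V) / d`. -/
noncomputable def wigner {S : QSystem} (V : S.Op) (u : S.Phase) : ℂ :=
  (pointOp S u * V).trace / (S.dim : ℂ)

/-- The Wigner trace norm `∑ u, |W_V(u)|`. -/
noncomputable def wignerTraceNorm {S : QSystem} (V : S.Op) : ℝ :=
  ∑ u : S.Phase, ‖wigner V u‖

/-- The mana `log₂ ‖V‖_{W,1}`, with value `-∞` if the norm vanishes. -/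
noncomputable def mana {S : QSystem} (V : S.Op) : EReal :=
  if wignerTraceNorm V = 0 then ⊥ else ((Real.logb 2 (wignerTraceNorm V) : ℝ) : EReal)

/-- The set `𝓦` of positive semi-definite operators with non-positive mana. -/
def subNormalized (S : QSystem) : Set S.Op :=
  {σ | mana σ ≤ 0 ∧ σ.PosSemidef}

/-- The support of a Hermitian operator, i.e. its range. -/
def opSupport {S : QSystem} (ρ : S.Op) : Submodule ℂ (S.Idx → ℂ) :=
  LinearMap.range ρ.mulVecLin

/-- The orthogonal projection onto the support of a Hermitian operator, as the spectral projection
for the non-zero eigenvalues. -/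
noncomputable def supportProj {S : QSystem} (ρ : S.Op) : S.Op :=
  cfc (fun x : ℝ => if x = 0 then (0 : ℝ) else 1) ρ

/-- The Petz-Rényi relative entropy of order zero, `-log₂ tr (P_ρ σ)`, with value `+∞` if the trace
vanishes. -/
noncomputable def petzZero {S : QSystem} (ρ σ : S.Op) : EReal :=
  if (supportProj ρ * σ).trace.re = 0 then ⊤
  else ((-Real.logb 2 (supportProj ρ * σ).trace.re : ℝ) : EReal)

/-- The max-relative entropy `inf {t : ρ ≤ 2 ^ t σ}`, with value `+∞` if there is no such `t`. -/
noncomputable def maxRelEntropy {S : QSystem} (ρ σ : S.Op) : EReal :=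
  ⨅ (t : ℝ) (_ : (((2 : ℝ) ^ t) • σ - ρ).PosSemidef), (t : EReal)

open Classical in
/-- The quantum relative entropy `tr (ρ (log₂ ρ - log₂ σ))`, with value `+∞` if the support of `ρ` is
not contained in that of `σ`. The logarithms are taken on the supports (`Real.logb 2 0 = 0`). -/
noncomputable def relEntropy {S : QSystem} (ρ σ : S.Op) : EReal :=
  if opSupport ρ ≤ opSupport σ then
    (((ρ * (cfc (Real.logb 2) ρ - cfc (Real.logb 2) σ)).trace.re : ℝ) : EReal)
  else ⊤

/-- The min-thauma. -/
noncomputable def minThauma {S : QSystem} (ρ : S.Op) : EReal :=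
  ⨅ σ ∈ subNormalized S, petzZero ρ σ

/-- The max-thauma. -/
noncomputable def maxThauma {S : QSystem} (ρ : S.Op) : EReal :=
  ⨅ σ ∈ subNormalized S, maxRelEntropy ρ σ

/-- The (relative-entropy) thauma. -/
noncomputable def thauma {S : QSystem} (ρ : S.Op) : EReal :=
  ⨅ σ ∈ subNormalized S, relEntropy ρ σ

/-- The regularized thauma `lim θ(ρ^{⊗n}) / n`. -/
noncomputable def regThauma {S : QSystem} (ρ : S.Op) : EReal :=
  limUnder atTop fun n : ℕ => thauma (tensorPow ρ n) / (n : EReal)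

/-! The phase-space point operators are Hermitian, mutually orthogonal for the trace pairing, `D²`
in number, and factor over tensor products. In Wigner coordinates a Hermitian operator is therefore
a real vector, the trace pairing is `D` times the Euclidean one, `wignerTraceNorm` is the `ℓ¹` norm
and is multiplicative on tensor products, and the positive semi-definite operators form a closed
self-dual cone.

Both extremal thaumas are logarithms of convex programs. The min-thauma is `-log₂ max {tr (P_ρ σ) :
σ ∈ 𝓦}`, with dual `min {max_u |tr (A_u Q)| : Q ≥ P_ρ}`. The max-thauma is `log₂ min {‖V‖_{W,1} : V
≥ ρ}`, with dual `max {tr (ρ Y) : Y ≥ 0, |tr (A_u Y)| ≤ 1 for all u}`. `exists_primal_dual_optimal`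
gives strong duality with attainment for both, with the `ℓ¹` and sup norms in exchanged roles.
Tensor products of feasible points are feasible on the primal and on the dual side, and their values
multiply. So a product of optimal pairs is an optimal pair, and the logarithms add
(`IsMinCertificate.tensor`, `IsMaxCertificate.tensor`).

For the regularization, expanding in eigenbases turns the relative entropy into an average of
logarithms. Jensen's inequality then gives `minThauma ≤ thauma ≤ maxThauma`, and both bounds grow
linearly on tensor powers. Since `𝓦` is closed under tensor products, `thauma` is subadditive, and
Fekete's lemma yields the limit and its two bounds. -/

section Qudit

/-! ### Phase-space point operators of a single qudit. -/

variable {d : ℕ} [NeZero d]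

theorem shiftOp_pow (n : ℕ) :
    shiftOp d ^ n = Matrix.of fun i j : ZMod d => if i = j + n then (1 : ℂ) else 0 := by
  induction n with
  | zero => ext i j; simp [Matrix.one_apply]
  | succ n ih =>
    rw [pow_succ, ih]
    ext i j
    simp [Matrix.mul_apply, shiftOp]
    congr 2
    ring

theorem boostOp_pow (n : ℕ) :
    boostOp d ^ n = Matrix.diagonal fun j : ZMod d => ZMod.stdAddChar ((n : ZMod d) * j) := by
  have h : ∀ j : ZMod d, Complex.exp (2 * Real.pi * Complex.I / d) ^ j.val
      = ZMod.stdAddChar j := by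
    intro j
    rw [ZMod.stdAddChar_apply, ZMod.toCircle_apply, ← Complex.exp_nat_mul]
    congr 1
    ring
  rw [boostOp, Matrix.diagonal_pow]
  congr 1
  ext j
  rw [Pi.pow_apply, h, ← AddChar.map_nsmul_eq_pow, nsmul_eq_mul]

/-- With `d = 2k + 1` the inverse of `2` modulo `d` is `k + 1`, and `(d + 1)/d = 2(k + 1)/d`. Hence
`τ` is a `d`-th root of unity, and all Weyl phases can be computed in `ZMod d`. -/
theorem exp_eq_stdAddChar_half (ho : Odd d) [Fact d.Prime] :
    Complex.exp ((d + 1) * Real.pi * Complex.I / d) = ZMod.stdAddChar (2⁻¹ : ZMod d) := by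
  obtain ⟨k, hk⟩ := ho
  have h2 : (2 : ZMod d) * ((k + 1 : ℕ) : ZMod d) = 1 := by
    have : ((2 * k + 1 : ℕ) : ZMod d) = 0 := by rw [← hk]; simp
    push_cast at this ⊢
    linear_combination this
  rw [inv_eq_of_mul_eq_one_right h2, ZMod.stdAddChar_apply, ZMod.toCircle_natCast]
  congr 1
  rw [hk]
  push_cast
  ring

theorem star_stdAddChar (x : ZMod d) :
    star (ZMod.stdAddChar x : ℂ) = ZMod.stdAddChar (-x) := by
  rw [ZMod.stdAddChar_apply, ZMod.stdAddChar_apply, AddChar.map_neg_eq_inv, Circle.coe_inv_eq_conj]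
  rfl

theorem sum_stdAddChar_mul (b : ZMod d) :
    ∑ a : ZMod d, (ZMod.stdAddChar (a * b) : ℂ) = if b = 0 then (d : ℂ) else 0 := by
  rw [AddChar.sum_mulShift b (ZMod.isPrimitive_stdAddChar d), ZMod.card]
  split_ifs <;> simp

theorem ZMod.two_ne_zero_of_odd [Fact d.Prime] (ho : Odd d) : (2 : ZMod d) ≠ 0 := by
  intro h
  have h' : ((2 : ℕ) : ZMod d) = 0 := by exact_mod_cast h
  rw [ZMod.natCast_eq_zero_iff] at h'
  have := (Nat.prime_dvd_prime_iff_eq (Fact.out) Nat.prime_two).1 h'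
  subst this
  exact absurd ho (by decide)


/-- The Heisenberg-Weyl operators of a qudit. -/
noncomputable def quditWeyl (d : ℕ) [NeZero d] (u : ZMod d × ZMod d) : Matrix (ZMod d) (ZMod d) ℂ :=
  Complex.exp ((d + 1) * Real.pi * Complex.I / d) ^ (-((u.1.val : ℤ) * (u.2.val : ℤ))) •
    (boostOp d ^ u.1.val * shiftOp d ^ u.2.val)

/-- The phase-space point operator of a qudit at the origin. -/
noncomputable def quditPointOpZero (d : ℕ) [NeZero d] : Matrix (ZMod d) (ZMod d) ℂ :=
  ((Fintype.card (ZMod d) : ℕ) : ℂ)⁻¹ • ∑ u, quditWeyl d u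

/-- The phase-space point operators of a qudit. -/
noncomputable def quditPointOp (d : ℕ) [NeZero d] (u : ZMod d × ZMod d) :
    Matrix (ZMod d) (ZMod d) ℂ :=
  quditWeyl d u * quditPointOpZero d * (quditWeyl d u).conjTranspose

theorem quditWeyl_apply [Fact d.Prime] (ho : Odd d) (a b i j : ZMod d) :
    quditWeyl d (a, b) i j =
      if i = j + b then ZMod.stdAddChar (a * i - 2⁻¹ * a * b) else 0 := by
  rw [quditWeyl, exp_eq_stdAddChar_half ho, boostOp_pow, shiftOp_pow, ← AddChar.map_zsmul_eq_zpow,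
    Matrix.smul_apply, Matrix.diagonal_mul]
  simp only [ZMod.natCast_val, ZMod.cast_id', id, Matrix.of_apply, mul_ite, mul_one, mul_zero,
    smul_eq_mul, zsmul_eq_mul]
  split_ifs with hij
  · rw [← AddChar.map_add_eq_mul]
    congr 1
    push_cast
    ring
  · rfl

/-- The entry fixes the shift `b = i - j`, and what remains is a character sum over `a` with
frequency `(i + j)/2`. The result is the parity operator `|j⟩ ↦ |-j⟩`; oddness of `d` enters through
the division by two. -/
theorem quditPointOpZero_apply [Fact d.Prime] (ho : Odd d) (i j : ZMod d) :
    quditPointOpZero d i j = if i + j = 0 then 1 else 0 := by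
  have h2 := ZMod.two_ne_zero_of_odd ho
  have hd0 : (d : ℂ) ≠ 0 := NeZero.ne _
  rw [quditPointOpZero, ZMod.card, Matrix.smul_apply, Matrix.sum_apply, Fintype.sum_prod_type,
    smul_eq_mul]
  have h1 : ∀ a b : ZMod d, quditWeyl d (a, b) i j
      = if b = i - j then ZMod.stdAddChar (a * (2⁻¹ * (i + j))) else 0 := by
    intro a b
    rw [quditWeyl_apply ho]
    by_cases hb : b = i - j
    · subst hb
      rw [if_pos (by ring), if_pos rfl]
      congr 1
      field_simp
      ring
    · rw [if_neg hb, if_neg]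
      rintro rfl
      exact hb (by ring)
  simp only [h1, Finset.sum_ite_eq', Finset.mem_univ, if_true, sum_stdAddChar_mul, mul_eq_zero,
    inv_eq_zero, h2, false_or]
  split_ifs <;> simp [hd0]

theorem quditPointOp_apply [Fact d.Prime] (ho : Odd d) (a b i j : ZMod d) :
    quditPointOp d (a, b) i j =
      if i + j = 2 * b then ZMod.stdAddChar (a * (i - j)) else 0 := by
  rw [quditPointOp, Matrix.mul_apply]
  simp only [Matrix.mul_apply, Matrix.conjTranspose_apply, quditWeyl_apply ho,
    quditPointOpZero_apply ho]
  -- A Weyl operator has one nonzero entry in each row, so each of the two sums keeps a single term.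
  rw [Finset.sum_eq_single (j - b), Finset.sum_eq_single (i - b)]
  · simp only [sub_add_cancel, if_true, star_stdAddChar]
    by_cases hij : i + j = 2 * b
    · rw [if_pos hij, if_pos (by linear_combination hij), mul_one, ← AddChar.map_add_eq_mul]
      congr 1
      ring
    · rw [if_neg hij, if_neg (fun h => hij (by linear_combination h))]
      simp
  · intro k _ hk
    rw [if_neg (fun h => hk (by rw [h]; ring))]
    simp
  · simp
  · intro k _ hk
    rw [if_neg (c := j = k + b) (fun h => hk (by rw [h]; ring))]
    simp
  · simp

theorem quditPointOp_isHermitian [Fact d.Prime] (ho : Odd d) (u : ZMod d × ZMod d) :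
    (quditPointOp d u).IsHermitian := by
  obtain ⟨a, b⟩ := u
  ext i j
  rw [Matrix.conjTranspose_apply, quditPointOp_apply ho, quditPointOp_apply ho, add_comm j i]
  split_ifs
  · rw [star_stdAddChar]
    congr 1
    ring
  · simp

/-- Each point operator is a reflection about `b` with phases, which forces `j = 2b - i` and `b =
b'`. Recentring `i` at `b` leaves a character sum in `a - a'`. -/
theorem trace_quditPointOp_mul [Fact d.Prime] (ho : Odd d) (u v : ZMod d × ZMod d) :
    (quditPointOp d u * quditPointOp d v).trace = if u = v then (d : ℂ) else 0 := by
  have h2 := ZMod.two_ne_zero_of_odd ho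
  obtain ⟨a, b⟩ := u
  obtain ⟨a', b'⟩ := v
  simp only [Matrix.trace, Matrix.diag_apply, Matrix.mul_apply, quditPointOp_apply ho]
  have h : ∀ i j : ZMod d, (if i + j = 2 * b then (ZMod.stdAddChar (a * (i - j)) : ℂ) else 0) *
      (if j + i = 2 * b' then (ZMod.stdAddChar (a' * (j - i)) : ℂ) else 0) =
      if j = 2 * b - i then
        (if b = b' then ZMod.stdAddChar ((i - b) * (2 * (a - a'))) else 0) else 0 := by
    intro i j
    by_cases hj : j = 2 * b - i
    · subst hj
      rw [if_pos (by ring), if_pos rfl]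
      by_cases hb : b = b'
      · subst hb
        rw [if_pos (by ring), if_pos rfl, ← AddChar.map_add_eq_mul]
        congr 1
        ring
      · rw [if_neg hb, if_neg, mul_zero]
        intro h
        exact hb (mul_left_cancel₀ h2 (by linear_combination h))
    · rw [if_neg hj, if_neg, zero_mul]
      intro h
      exact hj (by linear_combination h)
  simp only [h, Finset.sum_ite_eq', Finset.mem_univ, if_true, Prod.mk.injEq]
  by_cases hb : b = b'
  · simp only [hb, if_true, and_true]
    refine ((Equiv.subRight b').sum_comp
      fun x => (ZMod.stdAddChar (x * (2 * (a - a'))) : ℂ)).trans ?_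
    rw [sum_stdAddChar_mul]
    simp [h2, sub_eq_zero]
  · simp [hb]

end Qudit

/-! ### Tensor products of operators and of phase-space point operators. -/

section TensorOp

variable {A B : QSystem}

theorem tensorOp_mul (ρ ρ' : A.Op) (τ τ' : B.Op) :
    tensorOp ρ τ * tensorOp ρ' τ' = tensorOp (ρ * ρ') (τ * τ') :=
  (Matrix.mul_kronecker_mul ρ ρ' τ τ').symm

theorem conjTranspose_tensorOp (ρ : A.Op) (τ : B.Op) :
    (tensorOp ρ τ).conjTranspose = tensorOp ρ.conjTranspose τ.conjTranspose :=
  Matrix.conjTranspose_kronecker ρ τ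

theorem trace_tensorOp (ρ : A.Op) (τ : B.Op) :
    (tensorOp ρ τ).trace = ρ.trace * τ.trace :=
  Matrix.trace_kronecker ρ τ

theorem tensorOp_one : tensorOp (1 : A.Op) (1 : B.Op) = 1 :=
  Matrix.one_kronecker_one (α := ℂ) (m := A.Idx) (n := B.Idx)

theorem tensorOp_diagonal (a : A.Idx → ℂ) (b : B.Idx → ℂ) :
    tensorOp (Matrix.diagonal a : A.Op) (Matrix.diagonal b : B.Op) =
      (Matrix.diagonal fun k : A.Idx × B.Idx => a k.1 * b k.2 :
        Matrix (A.Idx × B.Idx) (A.Idx × B.Idx) ℂ) :=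
  Matrix.diagonal_kronecker_diagonal a b

theorem tensorOp_sub_left (ρ ρ' : A.Op) (τ : B.Op) :
    tensorOp (ρ - ρ') τ = tensorOp ρ τ - tensorOp ρ' τ := by
  ext i j
  exact sub_mul (ρ i.1 j.1) (ρ' i.1 j.1) (τ i.2 j.2)

theorem tensorOp_sub_right (ρ : A.Op) (τ τ' : B.Op) :
    tensorOp ρ (τ - τ') = tensorOp ρ τ - tensorOp ρ τ' := by
  ext i j
  exact mul_sub (ρ i.1 j.1) (τ i.2 j.2) (τ' i.2 j.2)

theorem posSemidef_tensorOp {ρ : A.Op} {τ : B.Op} (hρ : ρ.PosSemidef) (hτ : τ.PosSemidef) :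
    (tensorOp ρ τ).PosSemidef :=
  Matrix.PosSemidef.kronecker hρ hτ

/-- The tensor product is monotone on positive semi-definite operators. -/
theorem posSemidef_tensorOp_sub {ρ ρ' : A.Op} {τ τ' : B.Op} (hρ : ρ.PosSemidef)
    (hτ' : τ'.PosSemidef) (h : (ρ' - ρ).PosSemidef) (h' : (τ' - τ).PosSemidef) :
    (tensorOp ρ' τ' - tensorOp ρ τ).PosSemidef := by
  have key : tensorOp ρ' τ' - tensorOp ρ τ = tensorOp (ρ' - ρ) τ' + tensorOp ρ (τ' - τ) := by
    rw [tensorOp_sub_left, tensorOp_sub_right]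
    abel
  rw [key]
  exact (posSemidef_tensorOp h hτ').add (posSemidef_tensorOp hρ h')

theorem isState_tensorOp {ρ : A.Op} {τ : B.Op} (hρ : IsState ρ) (hτ : IsState τ) :
    IsState (tensorOp ρ τ) :=
  ⟨posSemidef_tensorOp hρ.1 hτ.1, by rw [trace_tensorOp, hρ.2, hτ.2, one_mul]⟩

theorem dim_tensor : (A.tensor B).dim = A.dim * B.dim :=
  Fintype.card_prod A.Idx B.Idx

theorem weyl_tensor (u : A.Phase) (v : B.Phase) :
    weyl (A.tensor B) ((u, v) : A.Phase × B.Phase) = tensorOp (weyl A u) (weyl B v) := rfl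

theorem sum_tensorOp_sum {ι κ : Type*} [Fintype ι] [Fintype κ] (f : ι → A.Op) (g : κ → B.Op) :
    tensorOp (∑ i, f i) (∑ j, g j) = ∑ k : ι × κ, tensorOp (f k.1) (g k.2) := by
  ext i j
  have h : (tensorOp (∑ i, f i) (∑ j, g j)) i j =
    (∑ k, f k) i.1 j.1 * (∑ k, g k) i.2 j.2 := rfl
  rw [h, Matrix.sum_apply, Matrix.sum_apply, Matrix.sum_apply, Finset.sum_mul_sum,
    Fintype.sum_prod_type]
  rfl

theorem smul_tensorOp_smul (a b : ℂ) (ρ : A.Op) (τ : B.Op) :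
    tensorOp (a • ρ) (b • τ) = (a * b) • tensorOp ρ τ :=
  (Matrix.smul_kronecker a ρ (b • τ)).trans
    ((congrArg _ (Matrix.kronecker_smul b ρ τ)).trans (smul_smul _ _ _))

theorem pointOpZero_tensor :
    pointOpZero (A.tensor B) = tensorOp (pointOpZero A) (pointOpZero B) := by
  rw [pointOpZero, pointOpZero, pointOpZero, smul_tensorOp_smul, sum_tensorOp_sum, dim_tensor,
    Nat.cast_mul, mul_inv]
  rfl

theorem pointOp_tensor (u : A.Phase) (v : B.Phase) :
    pointOp (A.tensor B) ((u, v) : A.Phase × B.Phase) = tensorOp (pointOp A u) (pointOp B v) := by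
  have h : pointOp (A.tensor B) ((u, v) : A.Phase × B.Phase) =
    weyl (A.tensor B) ((u, v) : A.Phase × B.Phase) * pointOpZero (A.tensor B) *
      (weyl (A.tensor B) ((u, v) : A.Phase × B.Phase)).conjTranspose := rfl
  rw [h, pointOp, pointOp, weyl_tensor, pointOpZero_tensor, conjTranspose_tensorOp,
    tensorOp_mul, tensorOp_mul]

end TensorOp

/-! ### Point operators of composite systems: Hermiticity, orthogonality, counting. -/

theorem pointOp_unit (u : QSystem.unit.Phase) : pointOp .unit u = 1 := by
  have hw : ∀ v, weyl .unit v = 1 := fun _ => rfl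
  have hd : QSystem.unit.dim = 1 := rfl
  have hc : Fintype.card QSystem.unit.Phase = 1 := rfl
  rw [pointOp, pointOpZero]
  simp [hw, hd, hc]

theorem pointOp_isHermitian : (S : QSystem) → (u : S.Phase) → (pointOp S u).IsHermitian
  | .unit, u => by
    rw [pointOp_unit]
    exact Matrix.isHermitian_one
  | .qudit d hd ho, u => by
    have : NeZero d := ⟨hd.ne_zero⟩
    have : Fact d.Prime := ⟨hd⟩
    exact quditPointOp_isHermitian ho u
  | .tensor A B, (u, v) => by
    have hA := pointOp_isHermitian A u
    have hB := pointOp_isHermitian B v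
    rw [Matrix.IsHermitian] at hA hB ⊢
    rw [pointOp_tensor, conjTranspose_tensorOp, hA, hB]

open Classical in
theorem trace_pointOp_mul_pointOp : (S : QSystem) → (u v : S.Phase) →
    (pointOp S u * pointOp S v).trace = if u = v then (S.dim : ℂ) else 0
  | .unit, u, v => by
    have hu : u = v := Subsingleton.elim (α := Unit) u v
    have hd : QSystem.unit.dim = 1 := rfl
    rw [pointOp_unit, pointOp_unit, if_pos hu, mul_one, Matrix.trace_one, hd]
    rfl
  | .qudit d hd ho, u, v => by
    have : NeZero d := ⟨hd.ne_zero⟩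
    have : Fact d.Prime := ⟨hd⟩
    have hd' : (QSystem.qudit d hd ho).dim = d := ZMod.card d
    rw [hd']
    refine (trace_quditPointOp_mul ho u v).trans ?_
    congr
  | .tensor A B, (u, u'), (v, v') => by
    rw [pointOp_tensor, pointOp_tensor, tensorOp_mul, trace_tensorOp,
      trace_pointOp_mul_pointOp A u v, trace_pointOp_mul_pointOp B u' v', dim_tensor]
    have : @Eq (A.tensor B).Phase (u, u') (v, v') ↔ u = v ∧ u' = v' := Prod.mk_inj
    simp only [this]
    by_cases h : u = v <;> by_cases h' : u' = v' <;> simp [h, h']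

theorem QSystem.dim_ne_zero : (S : QSystem) → S.dim ≠ 0
  | .unit => one_ne_zero
  | .qudit d hd _ => by
    have : NeZero d := ⟨hd.ne_zero⟩
    exact (ZMod.card d).trans_ne hd.ne_zero
  | .tensor A B => by
    rw [dim_tensor]
    exact mul_ne_zero A.dim_ne_zero B.dim_ne_zero

theorem QSystem.card_phase : (S : QSystem) → Fintype.card S.Phase = S.dim * S.dim
  | .unit => rfl
  | .qudit d hd _ => by
    have : NeZero d := ⟨hd.ne_zero⟩
    exact Fintype.card_prod (ZMod d) (ZMod d)
  | .tensor A B => by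
    rw [dim_tensor, mul_mul_mul_comm, ← A.card_phase, ← B.card_phase]
    exact Fintype.card_prod _ _

/-! ### Wigner coordinates, the Wigner trace norm and the positive cone. -/

section WignerFunction

variable {S : QSystem}

open Classical in
theorem wigner_sum_smul_pointOp (w : S.Phase → ℂ) (u : S.Phase) :
    wigner (∑ v, w v • pointOp S v) u = w u := by
  have hd : (S.dim : ℂ) ≠ 0 := by exact_mod_cast S.dim_ne_zero
  simp only [wigner, Finset.mul_sum, Matrix.trace_sum, Matrix.mul_smul, Matrix.trace_smul,
    trace_pointOp_mul_pointOp, smul_eq_mul, mul_ite, mul_zero, Finset.sum_ite_eq, Finset.mem_univ,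
    if_true]
  field_simp

/-- The phase-space point operators span the space of all operators. -/
theorem sum_wigner_smul_pointOp (V : S.Op) : ∑ u, wigner V u • pointOp S u = V := by
  let M : (S.Phase → ℂ) →ₗ[ℂ] S.Op := Fintype.linearCombination ℂ (pointOp S)
  have hM : ∀ w, M w = ∑ v, w v • pointOp S v := fun w => rfl
  have hinj : Function.Injective M := by
    intro w w' h
    ext u
    rw [← wigner_sum_smul_pointOp w u, ← wigner_sum_smul_pointOp w' u, ← hM, ← hM, h]
  -- Orthogonality gives independence; having exactly `D²` point operators then gives spanning.
  have hdim : Module.finrank ℂ (S.Phase → ℂ) = Module.finrank ℂ S.Op := by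
    rw [Module.finrank_fintype_fun_eq_card, Module.finrank_matrix, Module.finrank_self, mul_one,
      S.card_phase]
    rfl
  obtain ⟨w, rfl⟩ := (LinearMap.injective_iff_surjective_of_finrank_eq_finrank hdim).1 hinj V
  rw [hM]
  exact Finset.sum_congr rfl fun u _ => by rw [wigner_sum_smul_pointOp]

theorem trace_mul_eq_sum_wigner (V Q : S.Op) :
    (V * Q).trace = ∑ u, wigner V u * (pointOp S u * Q).trace := by
  conv_lhs => rw [← sum_wigner_smul_pointOp V]
  simp only [Finset.sum_mul, Matrix.trace_sum, Matrix.smul_mul, Matrix.trace_smul, smul_eq_mul]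

/-- Hölder's inequality between the `ℓ¹` and sup norms in Wigner coordinates; this is the source of
weak duality. -/
theorem norm_trace_mul_le {V Q : S.Op} {m : ℝ} (hQ : ∀ u, ‖(pointOp S u * Q).trace‖ ≤ m) :
    ‖(V * Q).trace‖ ≤ wignerTraceNorm V * m := by
  rw [trace_mul_eq_sum_wigner, wignerTraceNorm, Finset.sum_mul]
  refine (norm_sum_le _ _).trans (Finset.sum_le_sum fun u _ => ?_)
  rw [norm_mul]
  exact mul_le_mul_of_nonneg_left (hQ u) (norm_nonneg _)

theorem wigner_smul (c : ℝ) (V : S.Op) (u : S.Phase) : wigner (c • V) u = c * wigner V u := by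
  rw [wigner, Matrix.mul_smul, Matrix.trace_smul, Complex.real_smul, wigner, mul_div_assoc]

theorem wignerTraceNorm_nonneg (V : S.Op) : 0 ≤ wignerTraceNorm V :=
  Finset.sum_nonneg fun _ _ => norm_nonneg _

theorem wignerTraceNorm_smul (c : ℝ) (V : S.Op) :
    wignerTraceNorm (c • V) = |c| * wignerTraceNorm V := by
  simp only [wignerTraceNorm, wigner_smul, norm_mul, Finset.mul_sum, Complex.norm_real,
    Real.norm_eq_abs]

theorem eq_zero_of_wignerTraceNorm_eq_zero {V : S.Op} (h : wignerTraceNorm V = 0) : V = 0 := by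
  rw [wignerTraceNorm, Finset.sum_eq_zero_iff_of_nonneg fun _ _ => norm_nonneg _] at h
  rw [← sum_wigner_smul_pointOp V]
  exact Finset.sum_eq_zero fun u hu => by rw [norm_eq_zero.1 (h u hu), zero_smul]

theorem mem_subNormalized_iff {σ : S.Op} :
    σ ∈ subNormalized S ↔ σ.PosSemidef ∧ wignerTraceNorm σ ≤ 1 := by
  have h : mana σ ≤ 0 ↔ wignerTraceNorm σ ≤ 1 := by
    rw [mana]
    split_ifs with h0
    · simp [h0]
    · have hpos := (wignerTraceNorm_nonneg σ).lt_of_ne' h0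
      rw [← EReal.coe_zero, EReal.coe_le_coe_iff, Real.logb_nonpos_iff one_lt_two hpos]
  rw [subNormalized, Set.mem_ofPred_eq, h, and_comm]

theorem trace_pointOp_mul_tensorOp {A B : QSystem} (V : A.Op) (W : B.Op) (u : A.Phase)
    (v : B.Phase) :
    (pointOp (A.tensor B) ((u, v) : A.Phase × B.Phase) * tensorOp V W).trace =
      (pointOp A u * V).trace * (pointOp B v * W).trace := by
  rw [pointOp_tensor, tensorOp_mul, trace_tensorOp]

theorem wigner_tensorOp {A B : QSystem} (V : A.Op) (W : B.Op) (u : A.Phase) (v : B.Phase) :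
    wigner (tensorOp V W) ((u, v) : A.Phase × B.Phase) = wigner V u * wigner W v := by
  refine (congrArg (· / ((A.tensor B).dim : ℂ)) (trace_pointOp_mul_tensorOp V W u v)).trans ?_
  rw [dim_tensor, Nat.cast_mul, mul_div_mul_comm]
  rfl

theorem wignerTraceNorm_tensorOp {A B : QSystem} (V : A.Op) (W : B.Op) :
    wignerTraceNorm (tensorOp V W) = wignerTraceNorm V * wignerTraceNorm W := by
  have h : wignerTraceNorm (tensorOp V W) = ∑ k : A.Phase × B.Phase,
    ‖wigner (tensorOp V W) k‖ := rfl
  rw [h, Fintype.sum_prod_type, wignerTraceNorm, wignerTraceNorm, Finset.sum_mul_sum]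
  refine Finset.sum_congr rfl fun u _ => Finset.sum_congr rfl fun v _ => ?_
  exact (congrArg norm (wigner_tensorOp V W u v)).trans (norm_mul _ _)

theorem tensorOp_mem_subNormalized {A B : QSystem} {σ : A.Op} {σ' : B.Op}
    (h : σ ∈ subNormalized A) (h' : σ' ∈ subNormalized B) :
    tensorOp σ σ' ∈ subNormalized (A.tensor B) := by
  rw [mem_subNormalized_iff] at *
  refine ⟨posSemidef_tensorOp h.1 h'.1, ?_⟩
  rw [wignerTraceNorm_tensorOp]
  exact mul_le_one₀ h.2 (wignerTraceNorm_nonneg _) h'.2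

/-- The operator with a given real Wigner function. -/
noncomputable def ofWigner (S : QSystem) (w : S.Phase → ℝ) : S.Op :=
  ∑ u, (w u : ℂ) • pointOp S u

theorem wigner_ofWigner (w : S.Phase → ℝ) (u : S.Phase) : wigner (ofWigner S w) u = w u :=
  wigner_sum_smul_pointOp (fun u => (w u : ℂ)) u

theorem ofWigner_add (w w' : S.Phase → ℝ) :
    ofWigner S (w + w') = ofWigner S w + ofWigner S w' := by
  simp [ofWigner, add_smul, Finset.sum_add_distrib]

theorem ofWigner_smul (c : ℝ) (w : S.Phase → ℝ) :
    ofWigner S (c • w) = c • ofWigner S w := by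
  simp [ofWigner, Finset.smul_sum, mul_smul]

theorem ofWigner_sub (w w' : S.Phase → ℝ) :
    ofWigner S (w - w') = ofWigner S w - ofWigner S w' := by
  simp [ofWigner, sub_smul, Finset.sum_sub_distrib]

theorem ofWigner_isHermitian (w : S.Phase → ℝ) : (ofWigner S w).IsHermitian := by
  rw [Matrix.IsHermitian, ofWigner, Matrix.conjTranspose_sum]
  refine Finset.sum_congr rfl fun u _ => ?_
  rw [Matrix.conjTranspose_smul, (pointOp_isHermitian S u).eq]
  simp

theorem trace_mul_im_eq_zero {n : Type*} [Fintype n] {V W : Matrix n n ℂ} (hV : V.IsHermitian)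
    (hW : W.IsHermitian) : (V * W).trace.im = 0 := by
  have h : star (V * W).trace = (V * W).trace := by
    rw [← Matrix.trace_conjTranspose, Matrix.conjTranspose_mul, hV.eq, hW.eq, Matrix.trace_mul_comm]
  exact Complex.conj_eq_iff_im.1 h

theorem ofWigner_re_wigner {V : S.Op} (hV : V.IsHermitian) :
    ofWigner S (fun u => (wigner V u).re) = V := by
  conv_rhs => rw [← sum_wigner_smul_pointOp V]
  refine Finset.sum_congr rfl fun u _ => ?_
  congr 1
  apply Complex.ext
  · simp
  · rw [wigner, Complex.ofReal_im, ← Complex.ofReal_natCast, Complex.div_ofReal_im,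
      trace_mul_im_eq_zero (pointOp_isHermitian S u) hV, zero_div]

theorem trace_pointOp_mul_ofWigner (w : S.Phase → ℝ) (u : S.Phase) :
    (pointOp S u * ofWigner S w).trace = S.dim * w u := by
  have hd : (S.dim : ℂ) ≠ 0 := by exact_mod_cast S.dim_ne_zero
  have := wigner_ofWigner w u
  rw [wigner, div_eq_iff hd] at this
  rw [this, mul_comm]

theorem trace_ofWigner_mul_ofWigner (w w' : S.Phase → ℝ) :
    (ofWigner S w * ofWigner S w').trace = ((S.dim * ∑ u, w u * w' u : ℝ) : ℂ) := by
  rw [trace_mul_eq_sum_wigner]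
  simp only [wigner_ofWigner, trace_pointOp_mul_ofWigner]
  push_cast
  rw [Finset.mul_sum]
  exact Finset.sum_congr rfl fun u _ => by ring

theorem wignerTraceNorm_ofWigner (w : S.Phase → ℝ) :
    wignerTraceNorm (ofWigner S w) = ∑ u, |w u| := by
  simp only [wignerTraceNorm, wigner_ofWigner, Complex.norm_real, Real.norm_eq_abs]

theorem isClosed_setOf_posSemidef {n : Type*} [Fintype n] :
    IsClosed {M : Matrix n n ℂ | M.PosSemidef} := by
  have : {M : Matrix n n ℂ | M.PosSemidef} = {M | M.conjTranspose = M} ∩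
      ⋂ x : n → ℂ, {M | 0 ≤ star x ⬝ᵥ M.mulVec x} := by
    ext M
    simp [Matrix.posSemidef_iff_dotProduct_mulVec, Matrix.IsHermitian]
  rw [this]
  refine (isClosed_eq (by fun_prop) (by fun_prop)).inter (isClosed_iInter fun x => ?_)
  exact isClosed_le (by fun_prop) (by fun_prop)

theorem posSemidef_trace_mul_nonneg {n : Type*} [Fintype n] {V W : Matrix n n ℂ}
    (hV : V.PosSemidef) (hW : W.PosSemidef) : 0 ≤ (V * W).trace := by
  classical
  open scoped MatrixOrder in
  obtain ⟨X, rfl⟩ := CStarAlgebra.nonneg_iff_eq_star_mul_self.1 hV.nonneg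
  rw [Matrix.mul_assoc, Matrix.trace_mul_comm]
  exact (hW.mul_mul_conjTranspose_same X).trace_nonneg

/-- The Wigner functions of positive semi-definite operators. -/
def posWigner (S : QSystem) : Set (S.Phase → ℝ) := {w | (ofWigner S w).PosSemidef}

theorem isClosed_posWigner : IsClosed (posWigner S) := by
  refine isClosed_setOf_posSemidef.preimage ?_
  unfold ofWigner
  fun_prop

theorem zero_mem_posWigner : (0 : S.Phase → ℝ) ∈ posWigner S := by
  have : ofWigner S 0 = 0 := by simp [ofWigner]
  simp [posWigner, this, Matrix.PosSemidef.zero]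

theorem add_mem_posWigner {w w' : S.Phase → ℝ} (h : w ∈ posWigner S) (h' : w' ∈ posWigner S) :
    w + w' ∈ posWigner S := by
  rw [posWigner, Set.mem_ofPred_eq, ofWigner_add]
  exact Matrix.PosSemidef.add h h'

theorem smul_mem_posWigner {w : S.Phase → ℝ} (h : w ∈ posWigner S) {c : ℝ} (hc : 0 ≤ c) :
    c • w ∈ posWigner S := by
  rw [posWigner, Set.mem_ofPred_eq, ofWigner_smul]
  exact Matrix.PosSemidef.smul h hc

/-- Half of the self-duality of the positive cone: testing against the rank-one operators `x x†`
already forces positivity. -/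
theorem mem_posWigner_of_forall_nonneg {y : S.Phase → ℝ}
    (h : ∀ w ∈ posWigner S, 0 ≤ ∑ u, y u * w u) : y ∈ posWigner S := by
  refine Matrix.PosSemidef.of_dotProduct_mulVec_nonneg (ofWigner_isHermitian y) fun x => ?_
  have hR := Matrix.posSemidef_vecMulVec_self_star x
  have hw := ofWigner_re_wigner hR.isHermitian
  have h1 := h _ (show (ofWigner S _).PosSemidef from hw ▸ hR)
  have h2 := trace_ofWigner_mul_ofWigner y fun u => (wigner (Matrix.vecMulVec x (star x)) u).re
  rw [hw, Matrix.mul_vecMulVec, Matrix.trace_vecMulVec, dotProduct_comm] at h2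
  rw [h2]
  exact_mod_cast mul_nonneg (Nat.cast_nonneg _) h1

end WignerFunction

/-! ### Convex duality for a self-dual cone. -/

/-- Strong duality, with attainment on both sides, for maximizing a linear functional over the part
of a self-dual cone in the unit ball of a norm `N` with dual norm `N'`. -/
theorem exists_primal_dual_optimal {U : Type*} [Fintype U] (C : Set (U → ℝ)) (hC : IsClosed C)
    (h0 : 0 ∈ C) (hadd : ∀ w ∈ C, ∀ w' ∈ C, w + w' ∈ C)
    (hsmul : ∀ w ∈ C, ∀ c : ℝ, 0 ≤ c → c • w ∈ C)
    (hdual : ∀ y : U → ℝ, (∀ w ∈ C, 0 ≤ ∑ u, y u * w u) → y ∈ C)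
    (N N' : (U → ℝ) → ℝ) (hN0 : N 0 = 0) (hNpos : ∀ y, y ≠ 0 → 0 < N y)
    (hNsmul : ∀ (c : ℝ) y, 0 ≤ c → N (c • y) = c * N y)
    (hNcpt : IsCompact {y | N y ≤ 1}) (hN'cpt : ∀ m, IsCompact {y | N' y ≤ m})
    (hN'conv : ∀ m, Convex ℝ {y | N' y ≤ m})
    (hNN' : ∀ (m : ℝ) y, 0 ≤ m → ∃ q, N' q ≤ m ∧ ∑ u, y u * q u = m * N y) (p : U → ℝ) :
    ∃ s ∈ C, N s ≤ 1 ∧ ∃ q, q - p ∈ C ∧ N' q ≤ ∑ u, p u * s u := by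
  obtain ⟨s, ⟨hsC, hs1⟩, hmax⟩ := (hNcpt.inter_left hC).exists_isMaxOn
    ⟨0, h0, show N 0 ≤ 1 by rw [hN0]; exact zero_le_one⟩
    (f := fun s => ∑ u, p u * s u) (by fun_prop)
  refine ⟨s, hsC, hs1, ?_⟩
  set m := ∑ u, p u * s u with hm
  have hmax' : ∀ y ∈ C, N y ≤ 1 → ∑ u, p u * y u ≤ m := fun y hy hy1 => hmax ⟨hy, hy1⟩
  have hm0 : 0 ≤ m := by simpa using hmax' 0 h0 (by rw [hN0]; exact zero_le_one)
  by_contra hcon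
  push Not at hcon
  have hconv : Convex ℝ {q | q - p ∈ C} := by
    intro x hx y hy a b ha hb hab
    have : a • x + b • y - p = a • (x - p) + b • (y - p) := by
      have hp : p = (a + b) • p := by rw [hab, one_smul]
      conv_lhs => rw [hp]
      module
    rw [Set.mem_ofPred_eq, this]
    exact hadd _ (hsmul _ hx a ha) _ (hsmul _ hy b hb)
  have hclosed : IsClosed {q | q - p ∈ C} := hC.preimage (by fun_prop)
  -- If no dual point reaches the value `m`, the compact ball `N' ≤ m` misses the closed convex set
  -- `p + C`. The separating functional will give a primal point with value above `m`.
  obtain ⟨f, a, b, ha, hab, hb⟩ := geometric_hahn_banach_compact_closed (hN'conv m) (hN'cpt m)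
    hconv hclosed (Set.disjoint_left.2 fun q hq hq' => (hcon q hq').not_ge hq)
  classical
  let y : U → ℝ := fun u => f (Pi.single u 1)
  have hf : ∀ x, f x = ∑ u, y u * x u := by
    intro x
    conv_lhs => rw [pi_eq_sum_univ' x, map_sum]
    refine Finset.sum_congr rfl fun u _ => ?_
    rw [map_smul, smul_eq_mul, mul_comm]
  -- This `q` attains the largest value `m * N y` of the functional on the ball, so separation gives
  -- `m * N y < ⟨y, p⟩`.
  obtain ⟨q, hq, hyq⟩ := hNN' m y hm0
  have hlt : m * N y < ∑ u, y u * p u := by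
    have h1 := ha q hq
    have h2 := hb p (by simpa using h0)
    rw [hf] at h1 h2
    linarith
  have hyC : y ∈ C := by
    refine hdual y fun w hw => ?_
    by_contra hneg
    push Not at hneg
    have hray : ∀ c : ℝ, 0 ≤ c → b < (∑ u, y u * p u) + c * ∑ u, y u * w u := by
      intro c hc
      have := hb (p + c • w) (by simpa using hsmul w hw c hc)
      rwa [map_add, map_smul, hf, hf, smul_eq_mul] at this
    have hb0 := hray 0 le_rfl
    -- The functional exceeds `b` along the whole ray `p + c w`. If `⟨y, w⟩ < 0`, this `c` makes it
    -- equal to `b`.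
    have := hray (((∑ u, y u * p u) - b) / -(∑ u, y u * w u))
      (div_nonneg (by linarith) (by linarith))
    rw [div_mul_eq_mul_div, div_neg, mul_div_cancel_right₀ _ hneg.ne] at this
    linarith
  have hy0 : y ≠ 0 := by
    intro h
    rw [h, hN0] at hlt
    simp at hlt
  have hNy := hNpos y hy0
  -- The normalized `y` is primal feasible, yet its value is above the maximum `m`.
  have h1 := hmax' ((N y)⁻¹ • y) (hsmul y hyC _ (inv_nonneg.2 hNy.le))
    (by rw [hNsmul _ _ (inv_nonneg.2 hNy.le), inv_mul_cancel₀ hNy.ne'])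
  have h2 : ∑ u, p u * ((N y)⁻¹ • y) u = (N y)⁻¹ * ∑ u, y u * p u := by
    rw [Finset.mul_sum]
    exact Finset.sum_congr rfl fun u _ => by simp; ring
  rw [h2, inv_mul_le_iff₀ hNy] at h1
  linarith

/-! ### The dual pair of the `ℓ¹` and sup norms. -/

section NormPair

variable {U : Type*} [Fintype U]

theorem isCompact_sum_abs_le (m : ℝ) : IsCompact {y : U → ℝ | ∑ u, |y u| ≤ m} := by
  refine (isCompact_closedBall (0 : U → ℝ) m).of_isClosed_subset
    (isClosed_le (by fun_prop) (by fun_prop)) fun y hy => ?_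
  rw [mem_closedBall_zero_iff]
  refine (pi_norm_le_iff_of_nonneg ((Finset.sum_nonneg fun _ _ => abs_nonneg _).trans hy)).2
    fun u => ?_
  exact (Finset.single_le_sum (f := fun u => |y u|) (fun _ _ => abs_nonneg _)
    (Finset.mem_univ u)).trans hy

theorem convex_sum_abs_le (m : ℝ) : Convex ℝ {y : U → ℝ | ∑ u, |y u| ≤ m} := by
  intro x hx y hy a b ha hb hab
  have h : ∑ u, |(a • x + b • y) u| ≤ a * ∑ u, |x u| + b * ∑ u, |y u| := by
    rw [Finset.mul_sum, Finset.mul_sum, ← Finset.sum_add_distrib]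
    refine Finset.sum_le_sum fun u _ => (abs_add_le _ _).trans_eq ?_
    simp [abs_mul, abs_of_nonneg ha, abs_of_nonneg hb]
  have hx' : ∑ u, |x u| ≤ m := hx
  have hy' : ∑ u, |y u| ≤ m := hy
  have : a * ∑ u, |x u| + b * ∑ u, |y u| ≤ m :=
    calc _ ≤ a * m + b * m := by gcongr
      _ = m := by rw [← add_mul, hab, one_mul]
  exact h.trans this

theorem exists_norm_le_sum_mul_eq (m : ℝ) (y : U → ℝ) (hm : 0 ≤ m) :
    ∃ q : U → ℝ, ‖q‖ ≤ m ∧ ∑ u, y u * q u = m * ∑ u, |y u| := by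
  refine ⟨fun u => m * SignType.sign (y u), (pi_norm_le_iff_of_nonneg hm).2 fun u => ?_, ?_⟩
  · rw [norm_mul, Real.norm_of_nonneg hm]
    refine mul_le_of_le_one_right hm ?_
    rcases lt_trichotomy (y u) 0 with h | h | h <;> simp [h]
  · rw [Finset.mul_sum]
    refine Finset.sum_congr rfl fun u _ => ?_
    rw [mul_left_comm, self_mul_sign]

theorem exists_sum_abs_le_sum_mul_eq (m : ℝ) (y : U → ℝ) (hm : 0 ≤ m) :
    ∃ q : U → ℝ, ∑ u, |q u| ≤ m ∧ ∑ u, y u * q u = m * ‖y‖ := by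
  classical
  rcases isEmpty_or_nonempty U with hU | hU
  · exact ⟨0, by simpa using hm, by simp [Subsingleton.elim y 0]⟩
  · obtain ⟨u, hu⟩ := Finite.exists_max fun u => |y u|
    have hy : ‖y‖ = |y u| := le_antisymm ((pi_norm_le_iff_of_nonneg (abs_nonneg _)).2 hu)
      (norm_le_pi_norm y u)
    refine ⟨Pi.single u (m * SignType.sign (y u)), ?_, ?_⟩
    · rw [Finset.sum_eq_single u (by intro v _ hv; simp [hv]) (by simp), Pi.single_eq_same, abs_mul,
        abs_of_nonneg hm]
      refine mul_le_of_le_one_right hm ?_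
      rcases lt_trichotomy (y u) 0 with h | h | h <;> simp [h]
    · rw [Finset.sum_eq_single u (by intro v _ hv; simp [hv]) (by simp), Pi.single_eq_same, hy,
        mul_left_comm, self_mul_sign]

end NormPair

/-! ### Spectral decompositions and overlaps of eigenbases. -/

section Spectral

variable {n : Type*} [Fintype n]

/-- Squared moduli of the overlaps of two orthonormal bases. -/
noncomputable def overlap (U V : Matrix n n ℂ) (i j : n) : ℝ :=
  Complex.normSq ((U.conjTranspose * V) i j)

theorem overlap_nonneg (U V : Matrix n n ℂ) (i j : n) : 0 ≤ overlap U V i j :=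
  Complex.normSq_nonneg _

variable [DecidableEq n]

/-- `ρ` is diagonalized by the unitary matrix `U`, with eigenvalues `p`. -/
def IsSpectralDecomp (ρ U : Matrix n n ℂ) (p : n → ℝ) : Prop :=
  U * U.conjTranspose = 1 ∧ U.conjTranspose * U = 1 ∧
    ρ = U * Matrix.diagonal (fun i => (p i : ℂ)) * U.conjTranspose

theorem exists_isSpectralDecomp {ρ : Matrix n n ℂ} (h : ρ.IsHermitian) :
    ∃ U p, IsSpectralDecomp ρ U p := by
  refine ⟨h.eigenvectorUnitary, h.eigenvalues, ?_, ?_, ?_⟩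
  · exact Unitary.coe_mul_star_self h.eigenvectorUnitary
  · exact Unitary.coe_star_mul_self h.eigenvectorUnitary
  · conv_lhs => rw [h.spectral_theorem, Unitary.conjStarAlgAut_apply]
    rfl

theorem IsSpectralDecomp.isHermitian {ρ U : Matrix n n ℂ} {p : n → ℝ}
    (h : IsSpectralDecomp ρ U p) : ρ.IsHermitian := by
  rw [h.2.2]
  refine Matrix.isHermitian_mul_mul_conjTranspose _
    (Matrix.isHermitian_diagonal_of_self_adjoint _ ?_)
  ext i
  simp

theorem IsSpectralDecomp.eigenvalue_eq {ρ U : Matrix n n ℂ} {p : n → ℝ}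
    (h : IsSpectralDecomp ρ U p) :
    U.conjTranspose * ρ * U = Matrix.diagonal (fun i => (p i : ℂ)) := by
  rw [h.2.2]
  calc _ = (U.conjTranspose * U) * Matrix.diagonal (fun i => (p i : ℂ)) *
      (U.conjTranspose * U) := by simp only [Matrix.mul_assoc]
    _ = _ := by rw [h.2.1, one_mul, mul_one]

theorem IsSpectralDecomp.nonneg {ρ U : Matrix n n ℂ} {p : n → ℝ}
    (h : IsSpectralDecomp ρ U p) (hρ : ρ.PosSemidef) (i : n) : 0 ≤ p i := by
  have := (hρ.conjTranspose_mul_mul_same U).diag_nonneg (i := i)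
  rw [h.eigenvalue_eq, Matrix.diagonal_apply_eq] at this
  exact_mod_cast this

/-- An arbitrary diagonalization is allowed, so that product eigenbases of tensor products can be
used. On finitely many points `f` agrees with a polynomial, and polynomials commute with the algebra
homomorphism `φ`. -/
theorem IsSpectralDecomp.cfc_eq {ρ U : Matrix n n ℂ} {p : n → ℝ} (h : IsSpectralDecomp ρ U p)
    (f : ℝ → ℝ) :
    cfc f ρ = U * Matrix.diagonal (fun i => (f (p i) : ℂ)) * U.conjTranspose := by
  classical
  let φ : (n → ℝ) →ₐ[ℝ] Matrix n n ℂ := AlgHom.ofLinearMap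
    { toFun := fun q => U * Matrix.diagonal (fun i => (q i : ℂ)) * U.conjTranspose
      map_add' := fun q q' => by
        rw [← add_mul, ← mul_add, Matrix.diagonal_add]
        simp
      map_smul' := fun c q => by
        rw [RingHom.id_apply, ← smul_mul_assoc, ← mul_smul_comm, ← Matrix.diagonal_smul]
        congr 3
        ext i
        simp }
    (by simp [h.1])
    (fun q q' => by
      change _ = (U * _ * U.conjTranspose) * (U * _ * U.conjTranspose)
      calc _ = U * (Matrix.diagonal (fun i => (q i : ℂ)) * 1 * Matrix.diagonal (fun i => (q' i : ℂ)))
            * U.conjTranspose := by simp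
        _ = _ := by
          rw [← h.2.1]
          simp only [Matrix.mul_assoc])
  have hφ : ∀ q, φ q = U * Matrix.diagonal (fun i => (q i : ℂ)) * U.conjTranspose := fun _ => rfl
  -- Taking both the spectrum and the values of `p` as nodes avoids proving that these sets
  -- coincide.
  let s : Finset ℝ := (Matrix.finite_real_spectrum (A := ρ)).toFinset ∪ Finset.univ.image p
  let P := Lagrange.interpolate s id f
  have hP : ∀ x ∈ s, P.eval x = f x := fun x hx =>
    Lagrange.eval_interpolate_at_node f (Set.injOn_id _) hx
  have h1 : cfc f ρ = cfc P.eval ρ := cfc_congr fun x hx =>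
    (hP x (Finset.mem_union_left _ (by simpa using hx))).symm
  have hsa : IsSelfAdjoint ρ := h.isHermitian
  have hρ : ρ = φ p := h.2.2
  rw [h1, cfc_polynomial P ρ hsa]
  conv_lhs => rw [hρ, Polynomial.aeval_algHom_apply, hφ]
  congr 4
  ext i
  congr 1
  have h2 : Polynomial.aeval (Pi.evalAlgHom ℝ (fun _ : n => ℝ) i p) P =
    Pi.evalAlgHom ℝ (fun _ : n => ℝ) i (Polynomial.aeval p P) := Polynomial.aeval_algHom_apply _ _ _
  refine h2.symm.trans ?_
  rw [Polynomial.coe_aeval_eq_eval]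
  exact hP _ (Finset.mem_union_right _ (Finset.mem_image_of_mem _ (Finset.mem_univ i)))

theorem overlap_self_of_unitary {U : Matrix n n ℂ} (hU : U.conjTranspose * U = 1) (i j : n) :
    overlap U U i j = if i = j then 1 else 0 := by
  rw [overlap, hU, Matrix.one_apply]
  split_ifs <;> simp

theorem sum_overlap_right {U V : Matrix n n ℂ} (hU : U.conjTranspose * U = 1)
    (hV : V * V.conjTranspose = 1) (i : n) : ∑ j, overlap U V i j = 1 := by
  have h : (U.conjTranspose * V) * (U.conjTranspose * V).conjTranspose = 1 := by
    rw [Matrix.conjTranspose_mul, Matrix.conjTranspose_conjTranspose, Matrix.mul_assoc,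
      ← Matrix.mul_assoc V, hV, one_mul, hU]
  have := congrFun (congrFun h i) i
  rw [Matrix.mul_apply, Matrix.one_apply_eq] at this
  simp only [Matrix.conjTranspose_apply, Complex.star_def, Complex.mul_conj] at this
  exact_mod_cast this

theorem trace_mul_eq_sum_overlap (U V : Matrix n n ℂ) (a b : n → ℝ) :
    ((U * Matrix.diagonal (fun i => (a i : ℂ)) * U.conjTranspose) *
      (V * Matrix.diagonal (fun i => (b i : ℂ)) * V.conjTranspose)).trace =
      ((∑ i, ∑ j, a i * overlap U V i j * b j : ℝ) : ℂ) := by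
  have h : ((U * Matrix.diagonal (fun i => (a i : ℂ)) * U.conjTranspose) *
      (V * Matrix.diagonal (fun i => (b i : ℂ)) * V.conjTranspose)).trace =
      (Matrix.diagonal (fun i => (a i : ℂ)) * (U.conjTranspose * V) *
        (Matrix.diagonal (fun i => (b i : ℂ)) * (U.conjTranspose * V).conjTranspose)).trace := by
    rw [Matrix.mul_assoc U, Matrix.mul_assoc U, Matrix.trace_mul_comm, Matrix.conjTranspose_mul,
      Matrix.conjTranspose_conjTranspose]
    simp only [Matrix.mul_assoc]
  rw [h, Matrix.trace]
  push_cast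
  refine Finset.sum_congr rfl fun i _ => ?_
  rw [Matrix.diag_apply, Matrix.mul_apply]
  refine Finset.sum_congr rfl fun j _ => ?_
  rw [Matrix.diagonal_mul, Matrix.diagonal_mul, Matrix.conjTranspose_apply, overlap,
    Complex.normSq_eq_conj_mul_self]
  simp only [Complex.star_def]
  ring

theorem range_mulVecLin_le_iff {ρ σ : Matrix n n ℂ} :
    LinearMap.range ρ.mulVecLin ≤ LinearMap.range σ.mulVecLin ↔ ∃ X, ρ = σ * X := by
  constructor
  · intro h
    have : ∀ j, ∃ x, σ.mulVec x = ρ.col j := fun j =>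
      h ⟨Pi.single j 1, by simp⟩
    choose X hX using this
    refine ⟨(Matrix.of X).transpose, ?_⟩
    ext i j
    exact (congrFun (hX j) i).symm
  · rintro ⟨X, rfl⟩ _ ⟨x, rfl⟩
    exact ⟨X.mulVec x, by simp⟩

/-- The supports are nested exactly when no eigenvector of `ρ` with nonzero eigenvalue overlaps the
kernel of `σ`. -/
theorem range_mulVecLin_le_iff_overlap {ρ σ U V : Matrix n n ℂ} {p q : n → ℝ}
    (hρ : IsSpectralDecomp ρ U p) (hσ : IsSpectralDecomp σ V q) :
    LinearMap.range ρ.mulVecLin ≤ LinearMap.range σ.mulVecLin ↔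
      ∀ i j, p i ≠ 0 → q j = 0 → overlap U V i j = 0 := by
  have key : ∀ i j, (V.conjTranspose * ρ * U) j i = star ((U.conjTranspose * V) i j) * p i := by
    intro i j
    have : V.conjTranspose * ρ * U =
        (U.conjTranspose * V).conjTranspose * Matrix.diagonal (fun i => (p i : ℂ)) := by
      conv_lhs => rw [hρ.2.2]
      rw [Matrix.conjTranspose_mul, Matrix.conjTranspose_conjTranspose]
      simp only [Matrix.mul_assoc]
      rw [hρ.2.1, mul_one]
    rw [this, Matrix.mul_diagonal, Matrix.conjTranspose_apply]
  rw [range_mulVecLin_le_iff]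
  constructor
  · rintro ⟨X, hX⟩ i j hi hj
    have h1 : (V.conjTranspose * ρ * U) j i = 0 := by
      have : V.conjTranspose * ρ * U =
          Matrix.diagonal (fun i => (q i : ℂ)) * (V.conjTranspose * X * U) := by
        rw [hX, ← hσ.eigenvalue_eq]
        calc _ = V.conjTranspose * σ * 1 * X * U := by simp only [Matrix.mul_assoc, mul_one]
          _ = _ := by
            rw [← hσ.1]
            simp only [Matrix.mul_assoc]
      rw [this, Matrix.diagonal_mul, hj]
      simp
    rw [key, mul_eq_zero, star_eq_zero] at h1
    rcases h1 with h1 | h1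
    · rw [overlap, h1, map_zero]
    · exact absurd (by exact_mod_cast h1) hi
  · intro h
    -- The witness is the pseudo-inverse of `σ` times `ρ`; the convention `0⁻¹ = 0` handles the
    -- kernel.
    refine ⟨V * Matrix.diagonal (fun j => ((q j)⁻¹ : ℂ)) * V.conjTranspose * ρ, ?_⟩
    have h1 : V.conjTranspose * ρ * U = Matrix.diagonal (fun j => (q j : ℂ)) *
        (Matrix.diagonal (fun j => ((q j)⁻¹ : ℂ)) * (V.conjTranspose * ρ * U)) := by
      ext j i
      rw [Matrix.diagonal_mul, Matrix.diagonal_mul, key]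
      by_cases hj : q j = 0
      · by_cases hi : p i = 0
        · simp [hi]
        · have := h i j hi hj
          rw [overlap, Complex.normSq_eq_zero] at this
          simp [this]
      · rw [mul_inv_cancel_left₀ (by exact_mod_cast hj)]
    have h2 : V * (V.conjTranspose * ρ * U) * U.conjTranspose = ρ :=
      calc _ = (V * V.conjTranspose) * ρ * (U * U.conjTranspose) := by simp only [Matrix.mul_assoc]
        _ = ρ := by rw [hσ.1, hρ.1, one_mul, mul_one]
    rw [h1] at h2
    conv_lhs => rw [← h2]
    conv_rhs => rw [hσ.2.2]
    calc _ = V * Matrix.diagonal (fun j => (q j : ℂ)) * 1 * Matrix.diagonal (fun j => ((q j)⁻¹ : ℂ))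
          * V.conjTranspose * ρ * (U * U.conjTranspose) := by simp only [Matrix.mul_assoc, one_mul]
      _ = _ := by
        rw [hρ.1, mul_one, ← hσ.2.1]
        simp only [Matrix.mul_assoc]

end Spectral

/-- Jensen's inequality for the logarithm. -/
theorem sum_mul_logb_le_logb {ι : Type*} (s : Finset ι) {t x : ι → ℝ} {T : ℝ}
    (ht : ∀ k ∈ s, 0 ≤ t k) (ht1 : ∑ k ∈ s, t k = 1) (hx : ∀ k ∈ s, t k ≠ 0 → 0 < x k) (hT : 0 < T)
    (hle : ∑ k ∈ s, t k * x k ≤ T) : ∑ k ∈ s, t k * Real.logb 2 (x k) ≤ Real.logb 2 T := by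
  have h2 : 0 < Real.log 2 := Real.log_pos one_lt_two
  have key : ∑ k ∈ s, t k * (Real.log (x k) - Real.log T) ≤ 0 := by
    calc _ ≤ ∑ k ∈ s, (t k * x k * T⁻¹ - t k) := by
          refine Finset.sum_le_sum fun k hk => ?_
          by_cases h : t k = 0
          · simp [h]
          · have hxk := hx k hk h
            rw [← Real.log_div hxk.ne' hT.ne', mul_assoc, ← div_eq_mul_inv, ← mul_sub_one]
            -- The inequality rests on `log y ≤ y - 1` at `y = x k / T`.
            exact mul_le_mul_of_nonneg_left (Real.log_le_sub_one_of_pos (div_pos hxk hT)) (ht k hk)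
      _ = (∑ k ∈ s, t k * x k) * T⁻¹ - 1 := by
          rw [Finset.sum_sub_distrib, ← Finset.sum_mul, ht1]
      _ ≤ T * T⁻¹ - 1 := by gcongr
      _ = 0 := by rw [mul_inv_cancel₀ hT.ne', sub_self]
  simp only [mul_sub, Finset.sum_sub_distrib, ← Finset.sum_mul, ht1, one_mul] at key
  simp only [Real.logb, ← mul_div_assoc, ← Finset.sum_div]
  gcongr
  linarith

/-! ### Traces, relative entropy and operator inequalities in terms of overlaps. -/

section Spectral

variable {n : Type*} [Fintype n] [DecidableEq n] {ρ σ U V : Matrix n n ℂ} {p q : n → ℝ}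

theorem IsSpectralDecomp.trace_eq (h : IsSpectralDecomp ρ U p) :
    ρ.trace = ((∑ i, p i : ℝ) : ℂ) := by
  rw [h.2.2, Matrix.mul_assoc, Matrix.trace_mul_comm, Matrix.mul_assoc, h.2.1, mul_one,
    Matrix.trace_diagonal]
  push_cast
  rfl

theorem IsSpectralDecomp.dotProduct_mulVec_eq (h : IsSpectralDecomp ρ U p) (x : n → ℂ) :
    star x ⬝ᵥ ρ.mulVec x = ((∑ i, p i * Complex.normSq (U.conjTranspose.mulVec x i) : ℝ) : ℂ) := by
  have h1 : star x ⬝ᵥ ρ.mulVec x = star (U.conjTranspose.mulVec x) ⬝ᵥ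
      (Matrix.diagonal (fun i => (p i : ℂ))).mulVec (U.conjTranspose.mulVec x) := by
    rw [Matrix.star_mulVec, Matrix.conjTranspose_conjTranspose, ← Matrix.dotProduct_mulVec,
      Matrix.mulVec_mulVec, Matrix.mulVec_mulVec, ← h.2.2]
  rw [h1, dotProduct]
  push_cast
  refine Finset.sum_congr rfl fun i _ => ?_
  rw [Matrix.mulVec_diagonal, Complex.normSq_eq_conj_mul_self, Pi.star_apply, Complex.star_def]
  ring

/-- The overlaps of a fixed `i` sum to one, so both logarithms can be put under the common weights
`p i * overlap U V i j`. For a state these weights form a probability distribution, which is what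
Jensen's inequality needs. -/
theorem trace_mul_log_sub_log (hρ : IsSpectralDecomp ρ U p) (hσ : IsSpectralDecomp σ V q) :
    (ρ * (cfc (Real.logb 2) ρ - cfc (Real.logb 2) σ)).trace.re =
      ∑ i, ∑ j, p i * overlap U V i j * (Real.logb 2 (p i) - Real.logb 2 (q j)) := by
  rw [mul_sub, Matrix.trace_sub, hρ.cfc_eq, hσ.cfc_eq]
  conv_lhs => rw [hρ.2.2]
  rw [trace_mul_eq_sum_overlap, trace_mul_eq_sum_overlap, ← Complex.ofReal_sub, Complex.ofReal_re,
    ← Finset.sum_sub_distrib]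
  refine Finset.sum_congr rfl fun i _ => ?_
  simp only [overlap_self_of_unitary hρ.2.1, mul_ite, mul_one, mul_zero, ite_mul, zero_mul,
    Finset.sum_ite_eq, Finset.mem_univ, if_true]
  have := sum_overlap_right hρ.2.1 hσ.1 i
  calc _ = (∑ j, overlap U V i j) * (p i * Real.logb 2 (p i)) -
        ∑ j, p i * overlap U V i j * Real.logb 2 (q j) := by rw [this, one_mul]
    _ = _ := by
      rw [Finset.sum_mul, ← Finset.sum_sub_distrib]
      exact Finset.sum_congr rfl fun j _ => by ring

theorem sum_eigenvalue_mul_overlap (hρ : IsSpectralDecomp ρ U p) (hσ : IsSpectralDecomp σ V q)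
    (h1 : ρ.trace = 1) : ∑ k : n × n, p k.1 * overlap U V k.1 k.2 = 1 := by
  rw [Fintype.sum_prod_type]
  simp only [← Finset.mul_sum, sum_overlap_right hρ.2.1 hσ.1, mul_one]
  have := hρ.trace_eq
  rw [h1] at this
  exact_mod_cast this.symm

/-- The inequality `ρ ≤ c σ` is tested on the vector `V y`, and only the `i`-th term of the
nonnegative sum for `ρ` is kept. Different choices of `y` give the next two estimates. -/
theorem eigenvalue_mul_normSq_le (hρ : IsSpectralDecomp ρ U p) (hσ : IsSpectralDecomp σ V q)
    (hp : ∀ i, 0 ≤ p i) {c : ℝ} (h : (c • σ - ρ).PosSemidef) (i : n) (y : n → ℂ) :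
    p i * Complex.normSq ((U.conjTranspose * V).mulVec y i) ≤
      c * ∑ j, q j * Complex.normSq (y j) := by
  have h1 := h.dotProduct_mulVec_nonneg (V.mulVec y)
  rw [Matrix.sub_mulVec, Matrix.smul_mulVec, dotProduct_sub, dotProduct_smul,
    hρ.dotProduct_mulVec_eq, hσ.dotProduct_mulVec_eq, Matrix.mulVec_mulVec, Matrix.mulVec_mulVec,
    hσ.2.1, Matrix.one_mulVec, Complex.real_smul, ← Complex.ofReal_mul, ← Complex.ofReal_sub,
    Complex.zero_le_real, sub_nonneg] at h1
  exact (Finset.single_le_sum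
    (f := fun i => p i * Complex.normSq ((U.conjTranspose * V).mulVec y i))
    (fun i _ => mul_nonneg (hp i) (Complex.normSq_nonneg _)) (Finset.mem_univ i)).trans h1

theorem eigenvalue_mul_overlap_le (hρ : IsSpectralDecomp ρ U p) (hσ : IsSpectralDecomp σ V q)
    (hp : ∀ i, 0 ≤ p i) {c : ℝ} (h : (c • σ - ρ).PosSemidef) (i j : n) :
    p i * overlap U V i j ≤ c * q j := by
  have := eigenvalue_mul_normSq_le hρ hσ hp h i (Pi.single j 1)
  rwa [Matrix.mulVec_single_one, Finset.sum_eq_single j (by intro k _ hk; simp [hk]) (by simp),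
    Pi.single_eq_same, map_one, mul_one] at this

theorem eigenvalue_mul_sum_overlap_div_le (hρ : IsSpectralDecomp ρ U p)
    (hσ : IsSpectralDecomp σ V q) (hp : ∀ i, 0 ≤ p i) (hq : ∀ j, 0 ≤ q j) {c : ℝ} (hc : 0 ≤ c)
    (h : (c • σ - ρ).PosSemidef) (i : n) : p i * ∑ j, overlap U V i j / q j ≤ c := by
  set s := ∑ j, overlap U V i j / q j with hs
  have hs0 : 0 ≤ s := Finset.sum_nonneg fun j _ => div_nonneg (overlap_nonneg _ _ _ _) (hq j)
  -- This test vector makes both sides expressible through `s`: the inequality becomes `p i * s² ≤ c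
  -- * s`, and one factor `s` cancels. Terms with `q j = 0` vanish by the convention for division by
  -- zero.
  have h1 := eigenvalue_mul_normSq_le hρ hσ hp h i
    fun j => star ((U.conjTranspose * V) i j) / (q j : ℂ)
  have h2 : (U.conjTranspose * V).mulVec (fun j => star ((U.conjTranspose * V) i j) / (q j : ℂ)) i
      = (s : ℂ) := by
    rw [Matrix.mulVec, dotProduct, hs]
    push_cast
    refine Finset.sum_congr rfl fun j _ => ?_
    rw [overlap, ← Complex.mul_conj, ← mul_div_assoc]
    rfl
  have h3 : ∑ j, q j * Complex.normSq (star ((U.conjTranspose * V) i j) / (q j : ℂ)) = s := by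
    refine Finset.sum_congr rfl fun j _ => ?_
    rw [map_div₀, Complex.normSq_ofReal, Complex.star_def, Complex.normSq_conj, overlap]
    by_cases hj : q j = 0
    · simp [hj]
    · field_simp
  rw [h2, h3, Complex.normSq_ofReal] at h1
  rcases hs0.eq_or_lt with h0 | h0
  · rw [← h0, mul_zero]
    exact hc
  · rw [← mul_assoc] at h1
    exact le_of_mul_le_mul_right h1 h0

end Spectral

/-! ### Comparison of the three relative entropies. -/

section RelativeEntropy

variable {S : QSystem} {ρ σ U V : S.Op} {p q : S.Idx → ℝ}

open Classical in
theorem relEntropy_eq (hρ : IsSpectralDecomp ρ U p) (hσ : IsSpectralDecomp σ V q) :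
    relEntropy ρ σ = if ∀ i j, p i ≠ 0 → q j = 0 → overlap U V i j = 0 then
      ((∑ i, ∑ j, p i * overlap U V i j * (Real.logb 2 (p i) - Real.logb 2 (q j)) : ℝ) : EReal)
      else ⊤ := by
  rw [relEntropy, trace_mul_log_sub_log hρ hσ]
  simp only [opSupport, range_mulVecLin_le_iff_overlap hρ hσ]

theorem trace_supportProj_mul (hρ : IsSpectralDecomp ρ U p) (hσ : IsSpectralDecomp σ V q) :
    (supportProj ρ * σ).trace.re =
      ∑ k : S.Idx × S.Idx, (if p k.1 = 0 then 0 else 1) * overlap U V k.1 k.2 * q k.2 := by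
  rw [supportProj, hρ.cfc_eq]
  conv_lhs => rw [hσ.2.2]
  rw [trace_mul_eq_sum_overlap, Complex.ofReal_re, Fintype.sum_prod_type]

theorem petzZero_le_relEntropy (hρ : IsState ρ) (hσ : σ.PosSemidef) :
    petzZero ρ σ ≤ relEntropy ρ σ := by
  obtain ⟨U, p, hU⟩ := exists_isSpectralDecomp hρ.1.isHermitian
  obtain ⟨V, q, hV⟩ := exists_isSpectralDecomp hσ.isHermitian
  have hp := hU.nonneg hρ.1
  have hq := hV.nonneg hσ
  rw [relEntropy_eq hU hV]
  split_ifs with hsupp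
  swap
  · exact le_top
  have hsum := sum_eigenvalue_mul_overlap hU hV hρ.2
  have hT := trace_supportProj_mul hU hV
  have hx : ∀ k : S.Idx × S.Idx, p k.1 * overlap U V k.1 k.2 ≠ 0 → 0 < p k.1 ∧ 0 < q k.2 := by
    intro k hk
    have hpk := left_ne_zero_of_mul hk
    exact ⟨(hp _).lt_of_ne' hpk,
      (hq _).lt_of_ne' fun h => right_ne_zero_of_mul hk (hsupp _ _ hpk h)⟩
  have hnn : ∀ k : S.Idx × S.Idx,
      0 ≤ (if p k.1 = 0 then 0 else 1) * overlap U V k.1 k.2 * q k.2 := fun k =>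
    mul_nonneg (mul_nonneg (by split_ifs <;> simp) (overlap_nonneg _ _ _ _)) (hq _)
  have hTpos : 0 < (supportProj ρ * σ).trace.re := by
    rw [hT]
    obtain ⟨k, _, hk⟩ := Finset.exists_ne_zero_of_sum_ne_zero (hsum.trans_ne one_ne_zero)
    obtain ⟨h1, h2⟩ := hx k hk
    refine Finset.sum_pos' (fun k _ => hnn k) ⟨k, Finset.mem_univ _, ?_⟩
    rw [if_neg h1.ne', one_mul]
    exact mul_pos ((overlap_nonneg _ _ _ _).lt_of_ne' (right_ne_zero_of_mul hk)) h2
  rw [petzZero, if_neg hTpos.ne', EReal.coe_le_coe_iff, neg_le]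
  -- The average of `log₂ (q j / p i)` is minus the relative entropy, while the average of `q j / p
  -- i` is exactly `tr (P_ρ σ)`.
  have key := sum_mul_logb_le_logb Finset.univ
    (t := fun k : S.Idx × S.Idx => p k.1 * overlap U V k.1 k.2)
    (x := fun k => q k.2 / p k.1) (fun k _ => mul_nonneg (hp _) (overlap_nonneg _ _ _ _)) hsum
    (fun k _ hk => div_pos (hx k hk).2 (hx k hk).1) hTpos (by
      rw [hT]
      refine Finset.sum_le_sum fun k _ => ?_
      by_cases h : p k.1 = 0
      · simp [h]
      · rw [if_neg h]
        refine le_of_eq ?_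
        field_simp)
  refine le_trans (le_of_eq ?_) key
  rw [Fintype.sum_prod_type, ← Finset.sum_neg_distrib]
  refine Finset.sum_congr rfl fun i _ => ?_
  rw [← Finset.sum_neg_distrib]
  refine Finset.sum_congr rfl fun j _ => ?_
  by_cases hk : p i * overlap U V i j = 0
  · simp [hk]
  · obtain ⟨h1, h2⟩ := hx (i, j) hk
    rw [Real.logb_div h2.ne' h1.ne']
    ring

theorem relEntropy_le_of_posSemidef (hρ : IsState ρ) (hσ : σ.PosSemidef) {t : ℝ}
    (h : (((2 : ℝ) ^ t) • σ - ρ).PosSemidef) : relEntropy ρ σ ≤ t := by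
  obtain ⟨U, p, hU⟩ := exists_isSpectralDecomp hρ.1.isHermitian
  obtain ⟨V, q, hV⟩ := exists_isSpectralDecomp hσ.isHermitian
  have hp := hU.nonneg hρ.1
  have hq := hV.nonneg hσ
  have hc : (0 : ℝ) < 2 ^ t := Real.rpow_pos_of_pos two_pos t
  have hsupp : ∀ i j, p i ≠ 0 → q j = 0 → overlap U V i j = 0 := by
    intro i j hi hj
    have := eigenvalue_mul_overlap_le hU hV hp h i j
    rw [hj, mul_zero] at this
    exact (mul_eq_zero.1 (this.antisymm (mul_nonneg (hp i) (overlap_nonneg _ _ _ _)))).resolve_left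
      hi
  rw [relEntropy_eq hU hV, if_pos hsupp, EReal.coe_le_coe_iff]
  have hsum := sum_eigenvalue_mul_overlap hU hV hρ.2
  have hx : ∀ k : S.Idx × S.Idx, p k.1 * overlap U V k.1 k.2 ≠ 0 → 0 < p k.1 ∧ 0 < q k.2 := by
    intro k hk
    have hpk := left_ne_zero_of_mul hk
    exact ⟨(hp _).lt_of_ne' hpk,
      (hq _).lt_of_ne' fun h => right_ne_zero_of_mul hk (hsupp _ _ hpk h)⟩
  have hp1 : ∑ i, p i = 1 := by
    have := hU.trace_eq
    rw [hρ.2] at this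
    exact_mod_cast this.symm
  -- Jensen's inequality for the reciprocal ratio: the average of `p i / q j` is at most `2 ^ t`, by
  -- applying `eigenvalue_mul_sum_overlap_div_le` for each `i` and averaging over `p`.
  have key := sum_mul_logb_le_logb Finset.univ
    (t := fun k : S.Idx × S.Idx => p k.1 * overlap U V k.1 k.2)
    (x := fun k => p k.1 / q k.2) (fun k _ => mul_nonneg (hp _) (overlap_nonneg _ _ _ _)) hsum
    (fun k _ hk => div_pos (hx k hk).1 (hx k hk).2) hc (by
      rw [Fintype.sum_prod_type]
      calc _ = ∑ i, p i * (p i * ∑ j, overlap U V i j / q j) := by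
            refine Finset.sum_congr rfl fun i _ => ?_
            rw [Finset.mul_sum, Finset.mul_sum]
            exact Finset.sum_congr rfl fun j _ => by ring
        _ ≤ ∑ i, p i * 2 ^ t := Finset.sum_le_sum fun i _ => mul_le_mul_of_nonneg_left
            (eigenvalue_mul_sum_overlap_div_le hU hV hp hq hc.le h i) (hp i)
        _ = 2 ^ t := by rw [← Finset.sum_mul, hp1, one_mul])
  rw [Real.logb_rpow two_pos (by norm_num)] at key
  refine le_trans (le_of_eq ?_) key
  rw [Fintype.sum_prod_type]
  refine Finset.sum_congr rfl fun i _ => Finset.sum_congr rfl fun j _ => ?_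
  by_cases hk : p i * overlap U V i j = 0
  · simp [hk]
  · obtain ⟨h1, h2⟩ := hx (i, j) hk
    rw [Real.logb_div h1.ne' h2.ne']

theorem minThauma_le_thauma (hρ : IsState ρ) : minThauma ρ ≤ thauma ρ :=
  iInf₂_mono fun _ hσ => petzZero_le_relEntropy hρ hσ.2

theorem thauma_le_maxThauma (hρ : IsState ρ) : thauma ρ ≤ maxThauma ρ :=
  iInf₂_mono fun _ hσ => le_iInf₂ fun _ ht => relEntropy_le_of_posSemidef hρ hσ.2 ht

end RelativeEntropy

/-! ### Optimality certificates for the two convex programs. -/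

section Certificates

variable {S A B : QSystem}

/-- Primal and dual optimal points `σ`, `Q`, with common value `m`, for the maximum of `tr (H σ)`
over `𝓦`. -/
structure IsMinCertificate (H σ Q : S.Op) (m : ℝ) : Prop where
  mem : σ ∈ subNormalized S
  trace_eq : (H * σ).trace = m
  le : (Q - H).PosSemidef
  norm_trace_le : ∀ u, ‖(pointOp S u * Q).trace‖ ≤ m

/-- Primal and dual optimal points `V`, `Y`, with common value `m`, for the minimum of the Wigner
trace norm over the operators above `H`. -/
structure IsMaxCertificate (H V Y : S.Op) (m : ℝ) : Prop where
  le : (V - H).PosSemidef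
  wignerTraceNorm_le : wignerTraceNorm V ≤ m
  posSemidef : Y.PosSemidef
  norm_trace_le : ∀ u, ‖(pointOp S u * Y).trace‖ ≤ 1
  trace_eq : (H * Y).trace = m

theorem exists_isMinCertificate {H : S.Op} (hH : H.IsHermitian) :
    ∃ σ Q m, IsMinCertificate H σ Q m := by
  have hp := ofWigner_re_wigner hH
  set p : S.Phase → ℝ := fun u => (wigner H u).re
  obtain ⟨s, hs, hs1, q, hq, hqm⟩ := exists_primal_dual_optimal (posWigner S) isClosed_posWigner
    zero_mem_posWigner (fun _ h _ h' => add_mem_posWigner h h')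
    (fun _ h _ hc => smul_mem_posWigner h hc) (fun _ h => mem_posWigner_of_forall_nonneg h)
    (fun y => ∑ u, |y u|) (fun y => ‖y‖) (by simp)
    (fun y hy => by
      obtain ⟨u, hu⟩ := Function.ne_iff.1 hy
      exact Finset.sum_pos' (fun _ _ => abs_nonneg _) ⟨u, Finset.mem_univ u, abs_pos.2 hu⟩)
    (fun c y hc => by simp [abs_mul, abs_of_nonneg hc, Finset.mul_sum])
    (isCompact_sum_abs_le 1)
    (fun m => by
      have : {y : S.Phase → ℝ | ‖y‖ ≤ m} = Metric.closedBall 0 m := by ext; simp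
      rw [this]
      exact isCompact_closedBall _ _)
    (fun m => by
      have : {y : S.Phase → ℝ | ‖y‖ ≤ m} = Metric.closedBall 0 m := by ext; simp
      rw [this]
      exact convex_closedBall _ _)
    exists_norm_le_sum_mul_eq p
  -- The factor `S.dim` converts the Euclidean pairing into the trace pairing; it appears equally in
  -- `tr (H σ)` and in `tr (A_u Q)`.
  refine ⟨ofWigner S s, ofWigner S q, S.dim * ∑ u, p u * s u, ?_, ?_, ?_, fun u => ?_⟩
  · rw [mem_subNormalized_iff, wignerTraceNorm_ofWigner]
    exact ⟨hs, hs1⟩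
  · conv_lhs => rw [← hp]
    rw [trace_ofWigner_mul_ofWigner]
  · conv in _ - H => rw [← hp]
    rw [← ofWigner_sub]
    exact hq
  · rw [trace_pointOp_mul_ofWigner, norm_mul, Complex.norm_natCast, Complex.norm_real]
    exact mul_le_mul_of_nonneg_left ((norm_le_pi_norm q u).trans hqm) (Nat.cast_nonneg _)

theorem exists_isMaxCertificate {H : S.Op} (hH : H.IsHermitian) :
    ∃ V Y m, IsMaxCertificate H V Y m := by
  have hd : (S.dim : ℝ) ≠ 0 := by exact_mod_cast S.dim_ne_zero
  have hp := ofWigner_re_wigner hH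
  set p : S.Phase → ℝ := fun u => (wigner H u).re
  obtain ⟨s, hs, hs1, q, hq, hqm⟩ := exists_primal_dual_optimal (posWigner S) isClosed_posWigner
    zero_mem_posWigner (fun _ h _ h' => add_mem_posWigner h h')
    (fun _ h _ hc => smul_mem_posWigner h hc) (fun _ h => mem_posWigner_of_forall_nonneg h)
    (fun y => ‖y‖) (fun y => ∑ u, |y u|) (by simp)
    (fun y hy => norm_pos_iff.2 hy)
    (fun c y hc => by rw [norm_smul, Real.norm_of_nonneg hc])
    (by
      have : {y : S.Phase → ℝ | ‖y‖ ≤ 1} = Metric.closedBall 0 1 := by ext; simp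
      rw [this]
      exact isCompact_closedBall _ _)
    isCompact_sum_abs_le convex_sum_abs_le exists_sum_abs_le_sum_mul_eq p
  -- Dividing by `S.dim` makes `tr (A_u Y) = s u`, so the sup-norm bound on `s` is the dual
  -- constraint.
  refine ⟨ofWigner S q, ofWigner S ((S.dim : ℝ)⁻¹ • s), ∑ u, p u * s u, ?_, ?_, ?_, fun u => ?_, ?_⟩
  · conv in _ - H => rw [← hp]
    rw [← ofWigner_sub]
    exact hq
  · rwa [wignerTraceNorm_ofWigner]
  · exact smul_mem_posWigner hs (inv_nonneg.2 (Nat.cast_nonneg _))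
  · rw [trace_pointOp_mul_ofWigner, norm_mul, Complex.norm_natCast, Complex.norm_real,
      Pi.smul_apply, norm_smul, norm_inv, Real.norm_natCast, mul_inv_cancel_left₀ hd]
    exact (norm_le_pi_norm s u).trans hs1
  · conv_lhs => rw [← hp]
    rw [trace_ofWigner_mul_ofWigner, Finset.mul_sum]
    congr 1
    refine Finset.sum_congr rfl fun u _ => ?_
    rw [Pi.smul_apply, smul_eq_mul]
    field_simp

theorem posSemidef_of_posSemidef_sub {n : Type*} {H Q : Matrix n n ℂ} (hH : H.PosSemidef)
    (h : (Q - H).PosSemidef) : Q.PosSemidef := by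
  simpa using h.add hH

theorem re_trace_mul_le {n : Type*} [Fintype n] {H Q σ : Matrix n n ℂ} (h : (Q - H).PosSemidef)
    (hσ : σ.PosSemidef) : (H * σ).trace.re ≤ (Q * σ).trace.re := by
  have := (Complex.le_def.1 (posSemidef_trace_mul_nonneg h hσ)).1
  rw [Matrix.sub_mul, Matrix.trace_sub, Complex.sub_re, Complex.zero_re] at this
  linarith

theorem re_trace_mul_le_of_norm_trace_le {Q σ : S.Op} {m : ℝ}
    (h : ∀ u, ‖(pointOp S u * Q).trace‖ ≤ m) : (Q * σ).trace.re ≤ wignerTraceNorm σ * m := by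
  rw [Matrix.trace_mul_comm]
  exact (Complex.re_le_norm _).trans (norm_trace_mul_le h)

theorem IsMinCertificate.re_trace_le {H σ Q : S.Op} {m : ℝ} (h : IsMinCertificate H σ Q m)
    {σ' : S.Op} (hσ' : σ'.PosSemidef) : (H * σ').trace.re ≤ wignerTraceNorm σ' * m :=
  (re_trace_mul_le h.le hσ').trans (re_trace_mul_le_of_norm_trace_le h.norm_trace_le)

/-- Weak duality against the identity bounds the positive number `tr H` by a nonnegative multiple of
`m`. -/
theorem IsMinCertificate.pos {H σ Q : S.Op} {m : ℝ} (h : IsMinCertificate H σ Q m)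
    (hH : H.PosSemidef) (hH0 : H ≠ 0) : 0 < m := by
  have h1 := h.re_trace_le Matrix.PosSemidef.one
  rw [mul_one] at h1
  have h2 := Complex.le_def.1 hH.trace_nonneg
  have h3 : 0 < H.trace.re := by
    refine h2.1.lt_of_ne fun h0 => hH0 (hH.trace_eq_zero_iff.1 ?_)
    exact Complex.ext h0.symm h2.2.symm
  exact pos_of_mul_pos_right (h3.trans_le h1) (wignerTraceNorm_nonneg _)

/-- All four conditions are multiplicative. Positivity of `H` and `H'` is what allows the two
operator inequalities to be tensored. -/
theorem IsMinCertificate.tensor {H σ Q : A.Op} {H' σ' Q' : B.Op} {m m' : ℝ}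
    (h : IsMinCertificate H σ Q m) (h' : IsMinCertificate H' σ' Q' m') (hH : H.PosSemidef)
    (hH' : H'.PosSemidef) :
    IsMinCertificate (tensorOp H H') (tensorOp σ σ') (tensorOp Q Q') (m * m') where
  mem := tensorOp_mem_subNormalized h.mem h'.mem
  trace_eq := by
    rw [tensorOp_mul, trace_tensorOp, h.trace_eq, h'.trace_eq, Complex.ofReal_mul]
  le := posSemidef_tensorOp_sub hH (posSemidef_of_posSemidef_sub hH' h'.le) h.le h'.le
  norm_trace_le := by
    rintro ⟨u, v⟩
    rw [trace_pointOp_mul_tensorOp, norm_mul]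
    exact mul_le_mul (h.norm_trace_le u) (h'.norm_trace_le v) (norm_nonneg _)
      ((norm_nonneg _).trans (h.norm_trace_le u))

theorem IsMaxCertificate.pos {ρ V Y : S.Op} {m : ℝ} (h : IsMaxCertificate ρ V Y m)
    (hρ : IsState ρ) : 0 < m := by
  by_contra hm
  have h0 : V = 0 := eq_zero_of_wignerTraceNorm_eq_zero
    ((h.wignerTraceNorm_le.trans (not_lt.1 hm)).antisymm (wignerTraceNorm_nonneg V))
  have h1 := (Complex.le_def.1 h.le.trace_nonneg).1
  rw [h0, zero_sub, Matrix.trace_neg, hρ.2] at h1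
  norm_num at h1

theorem IsMaxCertificate.tensor {H V Y : A.Op} {H' V' Y' : B.Op} {m m' : ℝ}
    (h : IsMaxCertificate H V Y m) (h' : IsMaxCertificate H' V' Y' m') (hH : H.PosSemidef)
    (hH' : H'.PosSemidef) :
    IsMaxCertificate (tensorOp H H') (tensorOp V V') (tensorOp Y Y') (m * m') where
  le := posSemidef_tensorOp_sub hH (posSemidef_of_posSemidef_sub hH' h'.le) h.le h'.le
  wignerTraceNorm_le := by
    rw [wignerTraceNorm_tensorOp]
    exact mul_le_mul h.wignerTraceNorm_le h'.wignerTraceNorm_le (wignerTraceNorm_nonneg _)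
      ((wignerTraceNorm_nonneg _).trans h.wignerTraceNorm_le)
  posSemidef := posSemidef_tensorOp h.posSemidef h'.posSemidef
  norm_trace_le := by
    rintro ⟨u, v⟩
    rw [trace_pointOp_mul_tensorOp, norm_mul]
    exact mul_le_one₀ (h.norm_trace_le u) (norm_nonneg _) (h'.norm_trace_le v)
  trace_eq := by
    rw [tensorOp_mul, trace_tensorOp, h.trace_eq, h'.trace_eq, Complex.ofReal_mul]

theorem posSemidef_supportProj {ρ : S.Op} (hρ : ρ.IsHermitian) : (supportProj ρ).PosSemidef := by
  obtain ⟨U, p, hU⟩ := exists_isSpectralDecomp hρ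
  rw [supportProj, hU.cfc_eq]
  refine Matrix.PosSemidef.mul_mul_conjTranspose_same (Matrix.PosSemidef.diagonal fun i => ?_) U
  by_cases h : p i = 0 <;> simp [h]

theorem supportProj_ne_zero {ρ : S.Op} (hρ : IsState ρ) : supportProj ρ ≠ 0 := by
  obtain ⟨U, p, hU⟩ := exists_isSpectralDecomp hρ.1.isHermitian
  intro h0
  -- The contradiction comes from `tr (P_ρ ρ) = tr ρ = 1`.
  have h1 := trace_supportProj_mul hU hU
  rw [h0, Matrix.zero_mul, Matrix.trace_zero, Complex.zero_re, Fintype.sum_prod_type] at h1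
  have h2 := hU.trace_eq
  rw [hρ.2] at h2
  have h3 : ∑ i, p i = 1 := by exact_mod_cast h2.symm
  refine zero_ne_one (h1.trans (Eq.trans (Finset.sum_congr rfl fun i _ => ?_) h3))
  simp only [overlap_self_of_unitary hU.2.1]
  by_cases h : p i = 0 <;> simp [h]

theorem IsMinCertificate.minThauma_eq {ρ σ Q : S.Op} {m : ℝ}
    (h : IsMinCertificate (supportProj ρ) σ Q m) (hρ : ρ.IsHermitian) (hm : 0 < m) :
    minThauma ρ = ((-Real.logb 2 m : ℝ) : EReal) := by
  refine le_antisymm (iInf₂_le_of_le σ h.mem ?_) (le_iInf₂ fun σ' hσ' => ?_)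
  · rw [petzZero, h.trace_eq, Complex.ofReal_re, if_neg hm.ne']
  · rw [mem_subNormalized_iff] at hσ'
    rw [petzZero]
    split_ifs with h0
    · exact le_top
    · have h1 := (Complex.le_def.1 (posSemidef_trace_mul_nonneg
        (posSemidef_supportProj hρ) hσ'.1)).1
      have h2 : (supportProj ρ * σ').trace.re ≤ m :=
        (h.re_trace_le hσ'.1).trans (mul_le_of_le_one_left hm.le hσ'.2)
      rw [EReal.coe_le_coe_iff]
      exact neg_le_neg (Real.logb_le_logb_of_le one_lt_two (h1.lt_of_ne' h0) h2)

/-- The normalized operator `V / m` lies in `𝓦` and attains `log₂ m`. Conversely, pairing `ρ ≤ 2 ^ t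
σ'` with `Y` gives `m ≤ 2 ^ t`. -/
theorem IsMaxCertificate.maxThauma_eq {ρ V Y : S.Op} {m : ℝ}
    (h : IsMaxCertificate ρ V Y m) (hρ : ρ.PosSemidef) (hm : 0 < m) :
    maxThauma ρ = ((Real.logb 2 m : ℝ) : EReal) := by
  refine le_antisymm (iInf₂_le_of_le (m⁻¹ • V) ?_ (iInf₂_le (Real.logb 2 m) ?_))
    (le_iInf₂ fun σ' hσ' => le_iInf₂ fun t ht => ?_)
  · rw [mem_subNormalized_iff, wignerTraceNorm_smul, abs_of_pos (inv_pos.2 hm)]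
    refine ⟨(posSemidef_of_posSemidef_sub hρ h.le).smul (inv_nonneg.2 hm.le), ?_⟩
    rw [inv_mul_le_iff₀ hm, mul_one]
    exact h.wignerTraceNorm_le
  · rw [Real.rpow_logb two_pos (by norm_num) hm, smul_inv_smul₀ hm.ne']
    exact h.le
  · rw [mem_subNormalized_iff] at hσ'
    have h2t : (0 : ℝ) < 2 ^ t := Real.rpow_pos_of_pos two_pos t
    have h1 := re_trace_mul_le ht h.posSemidef
    rw [h.trace_eq, Complex.ofReal_re, Matrix.trace_mul_comm] at h1
    have h2 := re_trace_mul_le_of_norm_trace_le (σ := (2 : ℝ) ^ t • σ') h.norm_trace_le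
    rw [wignerTraceNorm_smul, abs_of_pos h2t, mul_one] at h2
    have h3 : m ≤ 2 ^ t := h1.trans (h2.trans (mul_le_of_le_one_right h2t.le hσ'.2))
    rw [EReal.coe_le_coe_iff, Real.logb_le_iff_le_rpow one_lt_two hm]
    exact h3

end Certificates

/-! ### Product eigenbases and additivity of the min- and max-thauma. -/

section TensorSpectral

variable {A B : QSystem}

theorem IsSpectralDecomp.tensor {ρ U : A.Op} {p : A.Idx → ℝ} {τ V : B.Op} {q : B.Idx → ℝ}
    (hρ : IsSpectralDecomp ρ U p) (hτ : IsSpectralDecomp τ V q) :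
    IsSpectralDecomp (tensorOp ρ τ) (tensorOp U V) fun k => p k.1 * q k.2 := by
  refine ⟨?_, ?_, ?_⟩
  · rw [conjTranspose_tensorOp, tensorOp_mul, hρ.1, hτ.1, tensorOp_one]
  · rw [conjTranspose_tensorOp, tensorOp_mul, hρ.2.1, hτ.2.1, tensorOp_one]
  · have h : (Matrix.diagonal fun k => ((p k.1 * q k.2 : ℝ) : ℂ) : (A.tensor B).Op) =
        tensorOp (Matrix.diagonal fun i => (p i : ℂ)) (Matrix.diagonal fun j => (q j : ℂ)) := by
      rw [tensorOp_diagonal]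
      simp only [Complex.ofReal_mul]
      rfl
    conv_lhs => rw [hρ.2.2, hτ.2.2]
    rw [h, conjTranspose_tensorOp, tensorOp_mul, tensorOp_mul]

theorem overlap_tensorOp (U V : A.Op) (U' V' : B.Op) (i j : A.Idx) (i' j' : B.Idx) :
    overlap (tensorOp U U') (tensorOp V V') ((i, i') : A.Idx × B.Idx) ((j, j') : A.Idx × B.Idx) =
      overlap U V i j * overlap U' V' i' j' := by
  have h : (tensorOp U U').conjTranspose * tensorOp V V' =
      tensorOp (U.conjTranspose * V) (U'.conjTranspose * V') := by
    rw [conjTranspose_tensorOp, tensorOp_mul]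
  refine (congrArg (fun M : (A.tensor B).Op => Complex.normSq
    (M ((i, i') : A.Idx × B.Idx) ((j, j') : A.Idx × B.Idx))) h).trans ?_
  exact Complex.normSq_mul _ _

theorem supportProj_tensorOp {ρ : A.Op} {τ : B.Op} (hρ : ρ.IsHermitian) (hτ : τ.IsHermitian) :
    supportProj (tensorOp ρ τ) = tensorOp (supportProj ρ) (supportProj τ) := by
  obtain ⟨U, p, hU⟩ := exists_isSpectralDecomp hρ
  obtain ⟨V, q, hV⟩ := exists_isSpectralDecomp hτ
  have h : (Matrix.diagonal fun k => (((if p k.1 * q k.2 = 0 then 0 else 1 : ℝ)) : ℂ) :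
      (A.tensor B).Op) = tensorOp (Matrix.diagonal fun i => ((if p i = 0 then 0 else 1 : ℝ) : ℂ))
        (Matrix.diagonal fun j => ((if q j = 0 then 0 else 1 : ℝ) : ℂ)) := by
    rw [tensorOp_diagonal]
    refine congrArg (Matrix.diagonal (n := A.Idx × B.Idx)) (funext fun k => ?_)
    by_cases h1 : p k.1 = 0 <;> by_cases h2 : q k.2 = 0 <;> simp [h1, h2]
  rw [supportProj, supportProj, supportProj, (hU.tensor hV).cfc_eq, hU.cfc_eq, hV.cfc_eq, h,
    conjTranspose_tensorOp, tensorOp_mul, tensorOp_mul]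

theorem minThauma_tensorOp {ρ : A.Op} {τ : B.Op} (hρ : IsState ρ) (hτ : IsState τ) :
    minThauma (tensorOp ρ τ) = minThauma ρ + minThauma τ := by
  have hP := posSemidef_supportProj hρ.1.isHermitian
  have hP' := posSemidef_supportProj hτ.1.isHermitian
  obtain ⟨σ, Q, m, h⟩ := exists_isMinCertificate hP.isHermitian
  obtain ⟨σ', Q', m', h'⟩ := exists_isMinCertificate hP'.isHermitian
  have hm := h.pos hP (supportProj_ne_zero hρ)
  have hm' := h'.pos hP' (supportProj_ne_zero hτ)
  have ht := h.tensor h' hP hP'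
  rw [← supportProj_tensorOp hρ.1.isHermitian hτ.1.isHermitian] at ht
  rw [ht.minThauma_eq (isState_tensorOp hρ hτ).1.isHermitian (mul_pos hm hm'),
    h.minThauma_eq hρ.1.isHermitian hm, h'.minThauma_eq hτ.1.isHermitian hm', ← EReal.coe_add,
    Real.logb_mul hm.ne' hm'.ne', neg_add]

theorem maxThauma_tensorOp {ρ : A.Op} {τ : B.Op} (hρ : IsState ρ) (hτ : IsState τ) :
    maxThauma (tensorOp ρ τ) = maxThauma ρ + maxThauma τ := by
  obtain ⟨V, Y, m, h⟩ := exists_isMaxCertificate hρ.1.isHermitian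
  obtain ⟨V', Y', m', h'⟩ := exists_isMaxCertificate hτ.1.isHermitian
  have hm := h.pos hρ
  have hm' := h'.pos hτ
  rw [(h.tensor h' hρ.1 hτ.1).maxThauma_eq (isState_tensorOp hρ hτ).1 (mul_pos hm hm'),
    h.maxThauma_eq hρ.1 hm, h'.maxThauma_eq hτ.1 hm', ← EReal.coe_add,
    Real.logb_mul hm.ne' hm'.ne']

theorem exists_minThauma_eq {ρ : A.Op} (hρ : IsState ρ) : ∃ r : ℝ, minThauma ρ = r := by
  have hP := posSemidef_supportProj hρ.1.isHermitian
  obtain ⟨σ, Q, m, h⟩ := exists_isMinCertificate hP.isHermitian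
  exact ⟨_, h.minThauma_eq hρ.1.isHermitian (h.pos hP (supportProj_ne_zero hρ))⟩

theorem exists_maxThauma_eq {ρ : A.Op} (hρ : IsState ρ) : ∃ r : ℝ, maxThauma ρ = r := by
  obtain ⟨V, Y, m, h⟩ := exists_isMaxCertificate hρ.1.isHermitian
  exact ⟨_, h.maxThauma_eq hρ.1 (h.pos hρ)⟩

end TensorSpectral

/-! ### Subadditivity of the thauma. -/

section Subadditivity

variable {A B : QSystem}

theorem relEntropy_tensorOp_le {ρ σ : A.Op} {τ σ' : B.Op} (hρ : IsState ρ) (hτ : IsState τ)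
    (hσ : σ.IsHermitian) (hσ' : σ'.IsHermitian) :
    relEntropy (tensorOp ρ τ) (tensorOp σ σ') ≤ relEntropy ρ σ + relEntropy τ σ' := by
  obtain ⟨U, p, hU⟩ := exists_isSpectralDecomp hρ.1.isHermitian
  obtain ⟨V, q, hV⟩ := exists_isSpectralDecomp hσ
  obtain ⟨U', p', hU'⟩ := exists_isSpectralDecomp hτ.1.isHermitian
  obtain ⟨V', q', hV'⟩ := exists_isSpectralDecomp hσ'
  rw [relEntropy_eq hU hV, relEntropy_eq hU' hV', relEntropy_eq (hU.tensor hU') (hV.tensor hV')]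
  by_cases h : ∀ i j, p i ≠ 0 → q j = 0 → overlap U V i j = 0
  swap
  · rw [if_neg h, EReal.top_add_of_ne_bot]
    · exact le_top
    · split_ifs <;> simp
  by_cases h' : ∀ i j, p' i ≠ 0 → q' j = 0 → overlap U' V' i j = 0
  swap
  · rw [if_pos h, if_neg h', EReal.coe_add_top]
    exact le_top
  rw [if_pos h, if_pos h', if_pos, ← EReal.coe_add, EReal.coe_le_coe_iff]
  swap
  · rintro ⟨i, i'⟩ ⟨j, j'⟩ hi hj
    rw [overlap_tensorOp]
    rcases mul_eq_zero.1 hj with hj | hj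
    · rw [h i j (left_ne_zero_of_mul hi) hj, zero_mul]
    · rw [h' i' j' (right_ne_zero_of_mul hi) hj, mul_zero]
  have h1 := sum_eigenvalue_mul_overlap hU hV hρ.2
  have h1' := sum_eigenvalue_mul_overlap hU' hV' hτ.2
  rw [Fintype.sum_prod_type] at h1 h1'
  simp only [← Finset.mul_sum] at h1'
  -- The logarithm of a product splits only for nonzero factors. Where a weight is nonzero the
  -- support conditions guarantee this; elsewhere both sides vanish.
  have key : ∀ i i' j j', p i * p' i' * (overlap U V i j * overlap U' V' i' j') *
      (Real.logb 2 (p i * p' i') - Real.logb 2 (q j * q' j')) =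
      p i * overlap U V i j * (Real.logb 2 (p i) - Real.logb 2 (q j)) *
          (p' i' * overlap U' V' i' j') +
        p i * overlap U V i j *
          (p' i' * overlap U' V' i' j' * (Real.logb 2 (p' i') - Real.logb 2 (q' j'))) := by
    intro i i' j j'
    by_cases hk : p i * overlap U V i j = 0
    · rw [hk, mul_mul_mul_comm, hk]
      ring
    by_cases hk' : p' i' * overlap U' V' i' j' = 0
    · rw [mul_mul_mul_comm, hk']
      ring
    have hp := left_ne_zero_of_mul hk
    have hp' := left_ne_zero_of_mul hk'
    rw [Real.logb_mul hp hp', Real.logb_mul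
      (fun hq => right_ne_zero_of_mul hk (h i j hp hq))
      (fun hq => right_ne_zero_of_mul hk' (h' i' j' hp' hq))]
    ring
  refine le_of_eq ?_
  calc _ = ∑ k : A.Idx × B.Idx, ∑ l : A.Idx × B.Idx,
        p k.1 * p' k.2 * (overlap U V k.1 l.1 * overlap U' V' k.2 l.2) *
      (Real.logb 2 (p k.1 * p' k.2) - Real.logb 2 (q l.1 * q' l.2)) := by
        refine Finset.sum_congr rfl fun k _ => Finset.sum_congr rfl fun l _ => ?_
        exact congrArg (fun x => p k.1 * p' k.2 * x *
          (Real.logb 2 (p k.1 * p' k.2) - Real.logb 2 (q l.1 * q' l.2)))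
          (overlap_tensorOp U V U' V' k.1 l.1 k.2 l.2)
    _ = ∑ i, ∑ j, ∑ i', ∑ j',
        (p i * overlap U V i j * (Real.logb 2 (p i) - Real.logb 2 (q j)) *
          (p' i' * overlap U' V' i' j') + p i * overlap U V i j *
          (p' i' * overlap U' V' i' j' * (Real.logb 2 (p' i') - Real.logb 2 (q' j')))) := by
        simp only [key, Fintype.sum_prod_type]
        exact Finset.sum_congr rfl fun i _ => Finset.sum_comm
    _ = _ := by
        simp only [Finset.sum_add_distrib, ← Finset.mul_sum, h1', mul_one]
        simp only [← Finset.sum_mul, h1, one_mul]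

theorem thauma_ne_bot {ρ : A.Op} (hρ : IsState ρ) : thauma ρ ≠ ⊥ := by
  obtain ⟨r, hr⟩ := exists_minThauma_eq hρ
  intro h
  have := minThauma_le_thauma hρ
  rw [h, hr] at this
  simp at this

theorem thauma_ne_top {ρ : A.Op} (hρ : IsState ρ) : thauma ρ ≠ ⊤ := by
  obtain ⟨r, hr⟩ := exists_maxThauma_eq hρ
  intro h
  have := thauma_le_maxThauma hρ
  rw [h, hr] at this
  simp at this

theorem thauma_tensorOp_le {ρ : A.Op} {τ : B.Op} (hρ : IsState ρ) (hτ : IsState τ) :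
    thauma (tensorOp ρ τ) ≤ thauma ρ + thauma τ := by
  refine EReal.le_add_of_forall_gt (Or.inl (thauma_ne_bot hρ)) (Or.inl (thauma_ne_top hρ))
    fun a ha b hb => ?_
  obtain ⟨σ, ha⟩ := iInf_lt_iff.1 ha
  obtain ⟨hσ, ha⟩ := iInf_lt_iff.1 ha
  obtain ⟨σ', hb⟩ := iInf_lt_iff.1 hb
  obtain ⟨hσ', hb⟩ := iInf_lt_iff.1 hb
  exact (iInf₂_le _ (tensorOp_mem_subNormalized hσ hσ')).trans
    ((relEntropy_tensorOp_le hρ hτ hσ.2.isHermitian hσ'.2.isHermitian).trans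
      (add_le_add ha.le hb.le))

end Subadditivity

/-! ### Invariance under rebracketing of tensor products. -/

section Reindexing

theorem pointOp_tensor_apply {A B : QSystem} (u : A.Phase) (v : B.Phase) (i j : A.Idx)
    (i' j' : B.Idx) :
    pointOp (A.tensor B) ((u, v) : A.Phase × B.Phase) ((i, i') : A.Idx × B.Idx)
      ((j, j') : A.Idx × B.Idx) = pointOp A u i j * pointOp B v i' j' :=
  congrFun (congrFun (pointOp_tensor u v) ((i, i') : A.Idx × B.Idx)) ((j, j') : A.Idx × B.Idx)

/-- A relabelling of the computational basis that permutes the phase-space point operators. -/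
structure QSystem.Reindexing (A B : QSystem) where
  /-- The relabelling of the computational basis. -/
  idx : A.Idx ≃ B.Idx
  /-- The relabelling of the phase space. -/
  phase : A.Phase ≃ B.Phase
  pointOp_eq : ∀ u, pointOp A u = (pointOp B (phase u)).submatrix idx idx

variable {A B C S : QSystem}

namespace QSystem.Reindexing

theorem dim_eq (e : A.Reindexing B) : A.dim = B.dim := Fintype.card_congr e.idx

theorem trace_submatrix_equiv {m n : Type*} [Fintype m] [Fintype n] (e : m ≃ n)
    (M : Matrix n n ℂ) : (M.submatrix e e).trace = M.trace :=
  e.sum_comp fun i => M i i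

theorem wigner_submatrix (e : A.Reindexing B) (V : B.Op) (u : A.Phase) :
    wigner (V.submatrix e.idx e.idx : A.Op) u = wigner V (e.phase u) := by
  rw [wigner, wigner, e.pointOp_eq, Matrix.submatrix_mul_equiv, trace_submatrix_equiv,
    e.dim_eq]

theorem wignerTraceNorm_submatrix (e : A.Reindexing B) (V : B.Op) :
    wignerTraceNorm (V.submatrix e.idx e.idx : A.Op) = wignerTraceNorm V := by
  simp only [wignerTraceNorm, e.wigner_submatrix]
  exact e.phase.sum_comp fun u => ‖wigner V u‖

/-- Relabelling transports eigenbases together with their eigenvalues, so the overlap formula is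
merely reindexed. -/
theorem relEntropy_submatrix (e : A.Idx ≃ B.Idx) {ρ σ : B.Op} (hρ : ρ.IsHermitian)
    (hσ : σ.IsHermitian) :
    relEntropy (ρ.submatrix e e : A.Op) (σ.submatrix e e : A.Op) = relEntropy ρ σ := by
  have hdec : ∀ {ρ U : B.Op} {p : B.Idx → ℝ}, IsSpectralDecomp ρ U p →
      IsSpectralDecomp (ρ.submatrix e e : A.Op) (U.submatrix e e) (p ∘ e) := by
    intro ρ U p h
    refine ⟨?_, ?_, ?_⟩
    · rw [Matrix.conjTranspose_submatrix, Matrix.submatrix_mul_equiv, h.1,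
        Matrix.submatrix_one_equiv]
    · rw [Matrix.conjTranspose_submatrix, Matrix.submatrix_mul_equiv, h.2.1,
        Matrix.submatrix_one_equiv]
    · have hd : (Matrix.diagonal fun i => (((p ∘ e) i : ℝ) : ℂ) : A.Op) =
          (Matrix.diagonal fun i => (p i : ℂ) : B.Op).submatrix e e :=
        (Matrix.submatrix_diagonal_equiv (fun i => (p i : ℂ)) e).symm
      rw [hd, Matrix.conjTranspose_submatrix, Matrix.submatrix_mul_equiv,
        Matrix.submatrix_mul_equiv, ← h.2.2]
  obtain ⟨U, p, hU⟩ := exists_isSpectralDecomp hρ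
  obtain ⟨V, q, hV⟩ := exists_isSpectralDecomp hσ
  have hov : ∀ i j, overlap (U.submatrix e e : A.Op) (V.submatrix e e) i j =
      overlap U V (e i) (e j) := by
    intro i j
    rw [overlap, Matrix.conjTranspose_submatrix, Matrix.submatrix_mul_equiv]
    rfl
  rw [relEntropy_eq (hdec hU) (hdec hV), relEntropy_eq hU hV]
  simp only [hov, Function.comp_apply]
  rw [← e.sum_comp]
  simp only [← e.sum_comp fun j => p _ * overlap U V _ j * (Real.logb 2 (p _) - Real.logb 2 (q j))]
  simp only [e.forall_congr_left, Equiv.apply_symm_apply]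

theorem thauma_submatrix_le (e : A.Reindexing B) {ρ : B.Op} (hρ : ρ.IsHermitian) :
    thauma (ρ.submatrix e.idx e.idx : A.Op) ≤ thauma ρ := by
  refine le_iInf₂ fun σ hσ => iInf₂_le_of_le (σ.submatrix e.idx e.idx) ?_
    (relEntropy_submatrix e.idx hρ hσ.2.isHermitian).le
  rw [mem_subNormalized_iff] at hσ ⊢
  exact ⟨hσ.1.submatrix _, (e.wignerTraceNorm_submatrix σ).trans_le hσ.2⟩

/-- Composition of relabellings. -/
def trans (e : A.Reindexing B) (f : B.Reindexing C) : A.Reindexing C where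
  idx := e.idx.trans f.idx
  phase := e.phase.trans f.phase
  pointOp_eq u := by
    rw [e.pointOp_eq, f.pointOp_eq]
    rfl

/-- Relabelling the left factor of a tensor product. -/
def tensorRight (e : A.Reindexing B) (C : QSystem) : (A.tensor C).Reindexing (B.tensor C) where
  idx := Equiv.prodCongr e.idx (Equiv.refl C.Idx)
  phase := Equiv.prodCongr e.phase (Equiv.refl C.Phase)
  pointOp_eq := by
    rintro ⟨u, v⟩
    ext ⟨i, i'⟩ ⟨j, j'⟩
    refine (pointOp_tensor_apply u v i j i' j').trans
      (Eq.trans ?_ (pointOp_tensor_apply (e.phase u) v (e.idx i) (e.idx j) i' j').symm)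
    rw [e.pointOp_eq]
    rfl

/-- Associativity of the tensor product. -/
def assoc (A B C : QSystem) : ((A.tensor B).tensor C).Reindexing (A.tensor (B.tensor C)) where
  idx := Equiv.prodAssoc A.Idx B.Idx C.Idx
  phase := Equiv.prodAssoc A.Phase B.Phase C.Phase
  pointOp_eq := by
    rintro ⟨⟨u, v⟩, w⟩
    ext ⟨⟨i, i'⟩, i''⟩ ⟨⟨j, j'⟩, j''⟩
    have h := (pointOp_tensor_apply (A := A.tensor B) ((u, v) : A.Phase × B.Phase) w
      ((i, i') : A.Idx × B.Idx) ((j, j') : A.Idx × B.Idx) i'' j'').trans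
      (congrArg (· * pointOp C w i'' j'') (pointOp_tensor_apply u v i j i' j'))
    have h' := (pointOp_tensor_apply (B := B.tensor C) u ((v, w) : B.Phase × C.Phase) i j
      ((i', i'') : B.Idx × C.Idx) ((j', j'') : B.Idx × C.Idx)).trans
      (congrArg (pointOp A u i j * ·) (pointOp_tensor_apply v w i' j' i'' j''))
    exact h.trans ((mul_assoc _ _ _).trans h'.symm)

/-- The empty tensor product is a right unit. -/
def tensorUnit (A : QSystem) : A.Reindexing (A.tensor .unit) where
  idx := (Equiv.prodPUnit A.Idx).symm
  phase := (Equiv.prodPUnit A.Phase).symm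
  pointOp_eq u := by
    ext i j
    have h : pointOp .unit () () () = 1 :=
      (congrFun (congrFun (pointOp_unit ()) ()) ()).trans
        (Matrix.one_apply_eq (n := QSystem.unit.Idx) ())
    exact (mul_one _).symm.trans ((congrArg (pointOp A u i j * ·) h.symm).trans
      (pointOp_tensor_apply (B := .unit) u () i j () ()).symm)

end QSystem.Reindexing

/-- Powers are bracketed to the left, so the two sides live on different systems. The right unit
starts the induction on `n`, and associativity carries it on. -/
theorem exists_reindexing_tensorPow_add (ρ : S.Op) (m n : ℕ) :
    ∃ e : (S.pow (m + n)).Reindexing ((S.pow m).tensor (S.pow n)),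
      tensorPow ρ (m + n) =
        (tensorOp (tensorPow ρ m) (tensorPow ρ n)).submatrix e.idx e.idx := by
  induction n with
  | zero =>
    refine ⟨QSystem.Reindexing.tensorUnit (S.pow m), ?_⟩
    ext i j
    exact (mul_one _).symm
  | succ n ih =>
    obtain ⟨e, he⟩ := ih
    refine ⟨(e.tensorRight S).trans (QSystem.Reindexing.assoc _ _ _), ?_⟩
    have h : tensorPow ρ (m + (n + 1)) = tensorOp (tensorPow ρ (m + n)) ρ := rfl
    refine (h.trans (congrArg (tensorOp · ρ) he)).trans ?_
    ext i j
    exact mul_assoc _ _ _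

end Reindexing

/-! ### The regularized thauma. -/

section Regularization

variable {S : QSystem} {ρ : S.Op}

theorem isState_one_unit : IsState (1 : QSystem.unit.Op) := by
  refine ⟨Matrix.PosSemidef.one, ?_⟩
  have hc : Fintype.card QSystem.unit.Idx = 1 := rfl
  rw [Matrix.trace_one, hc, Nat.cast_one]

theorem isState_tensorPow (hρ : IsState ρ) : ∀ n, IsState (tensorPow ρ n)
  | 0 => isState_one_unit
  | n + 1 => isState_tensorOp (isState_tensorPow hρ n) hρ

theorem thauma_tensorPow_add_le (hρ : IsState ρ) (m n : ℕ) :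
    thauma (tensorPow ρ (m + n)) ≤ thauma (tensorPow ρ m) + thauma (tensorPow ρ n) := by
  obtain ⟨e, he⟩ := exists_reindexing_tensorPow_add ρ m n
  have hm := isState_tensorPow hρ m
  have hn := isState_tensorPow hρ n
  rw [he]
  exact (e.thauma_submatrix_le (isState_tensorOp hm hn).1.isHermitian).trans
    (thauma_tensorOp_le hm hn)

/-- The constant `c` comes from the empty tensor power. Its value is irrelevant, since it disappears
after division by `n`. -/
theorem minThauma_tensorPow (hρ : IsState ρ) {r c : ℝ} (hr : minThauma ρ = r)
    (hc : minThauma (1 : QSystem.unit.Op) = c) (n : ℕ) :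
    minThauma (tensorPow ρ n) = ((c + n * r : ℝ) : EReal) := by
  induction n with
  | zero =>
    rw [Nat.cast_zero, zero_mul, add_zero]
    exact hc
  | succ n ih =>
    refine (minThauma_tensorOp (isState_tensorPow hρ n) hρ).trans ?_
    rw [ih, hr, ← EReal.coe_add]
    congr 1
    push_cast
    ring

theorem maxThauma_tensorPow (hρ : IsState ρ) {r c : ℝ} (hr : maxThauma ρ = r)
    (hc : maxThauma (1 : QSystem.unit.Op) = c) (n : ℕ) :
    maxThauma (tensorPow ρ n) = ((c + n * r : ℝ) : EReal) := by
  induction n with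
  | zero =>
    rw [Nat.cast_zero, zero_mul, add_zero]
    exact hc
  | succ n ih =>
    refine (maxThauma_tensorOp (isState_tensorPow hρ n) hρ).trans ?_
    rw [ih, hr, ← EReal.coe_add]
    congr 1
    push_cast
    ring

theorem tendsto_add_mul_div (c r : ℝ) :
    Tendsto (fun n : ℕ => (c + n * r) / n) atTop (𝓝 r) := by
  have h := (tendsto_const_div_atTop_nhds_zero_nat c).add_const r
  rw [zero_add] at h
  refine h.congr' ?_
  -- At `n = 0` the right-hand quotient is `0` by convention, so the formulas need only agree
  -- eventually.
  filter_upwards [eventually_ne_atTop 0] with n hn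
  field_simp

theorem tendsto_regThauma (hρ : IsState ρ) :
    Tendsto (fun n : ℕ => thauma (tensorPow ρ n) / (n : EReal)) atTop (𝓝 (regThauma ρ)) ∧
      minThauma ρ ≤ regThauma ρ ∧ regThauma ρ ≤ maxThauma ρ := by
  obtain ⟨a, ha⟩ := exists_minThauma_eq hρ
  obtain ⟨a₀, ha₀⟩ := exists_minThauma_eq isState_one_unit
  obtain ⟨b, hb⟩ := exists_maxThauma_eq hρ
  obtain ⟨b₀, hb₀⟩ := exists_maxThauma_eq isState_one_unit
  set t : ℕ → ℝ := fun n => (thauma (tensorPow ρ n)).toReal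
  have ht : ∀ n, thauma (tensorPow ρ n) = t n := fun n =>
    (EReal.coe_toReal (thauma_ne_top (isState_tensorPow hρ n))
      (thauma_ne_bot (isState_tensorPow hρ n))).symm
  have hlow : ∀ n, a₀ + n * a ≤ t n := by
    intro n
    have := minThauma_le_thauma (isState_tensorPow hρ n)
    rwa [minThauma_tensorPow hρ ha ha₀, ht, EReal.coe_le_coe_iff] at this
  have hup : ∀ n, t n ≤ b₀ + n * b := by
    intro n
    have := thauma_le_maxThauma (isState_tensorPow hρ n)
    rwa [maxThauma_tensorPow hρ hb hb₀, ht, EReal.coe_le_coe_iff] at this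
  have hsub : Subadditive t := by
    intro m n
    have := thauma_tensorPow_add_le hρ m n
    rwa [ht, ht, ht, ← EReal.coe_add, EReal.coe_le_coe_iff] at this
  have hle : ∀ n : ℕ, (a₀ + n * a) / n ≤ t n / n := fun n =>
    div_le_div_of_nonneg_right (hlow n) (Nat.cast_nonneg n)
  -- Fekete's lemma needs a finite lower bound, supplied by the additive min-thauma: a convergent
  -- sequence lies below `t n / n`.
  have hbdd : BddBelow (Set.range fun n : ℕ => t n / n) := by
    obtain ⟨l, hl⟩ := (tendsto_add_mul_div a₀ a).bddBelow_range
    refine ⟨l, ?_⟩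
    rintro _ ⟨n, rfl⟩
    exact (hl ⟨n, rfl⟩).trans (hle n)
  have hlim := hsub.tendsto_lim hbdd
  have hlimE : Tendsto (fun n : ℕ => thauma (tensorPow ρ n) / (n : EReal)) atTop
      (𝓝 (hsub.lim : EReal)) := by
    refine ((continuous_coe_real_ereal.tendsto _).comp hlim).congr fun n => ?_
    rw [Function.comp_apply, ht, EReal.coe_div, EReal.coe_natCast]
  have hreg : regThauma ρ = hsub.lim := hlimE.limUnder_eq
  rw [hreg]
  refine ⟨hlimE, ?_, ?_⟩
  · rw [ha, EReal.coe_le_coe_iff]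
    exact le_of_tendsto_of_tendsto' (tendsto_add_mul_div a₀ a) hlim hle
  · rw [hb, EReal.coe_le_coe_iff]
    exact le_of_tendsto_of_tendsto' hlim (tendsto_add_mul_div b₀ b) fun n =>
      div_le_div_of_nonneg_right (hup n) (Nat.cast_nonneg n)

end Regularization

theorem proposition1 :
    (∀ (A B : QSystem) (ρ : A.Op) (τ : B.Op), IsState ρ → IsState τ →
      minThauma (tensorOp ρ τ) = minThauma ρ + minThauma τ ∧
      maxThauma (tensorOp ρ τ) = maxThauma ρ + maxThauma τ) ∧
    (∀ (A : QSystem) (ρ : A.Op), IsState ρ →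
      Tendsto (fun n : ℕ => thauma (tensorPow ρ n) / (n : EReal)) atTop (𝓝 (regThauma ρ)) ∧
      minThauma ρ ≤ regThauma ρ ∧ regThauma ρ ≤ maxThauma ρ) :=
  ⟨fun _ _ _ _ hρ hτ => ⟨minThauma_tensorOp hρ hτ, maxThauma_tensorOp hρ hτ⟩,
    fun _ _ hρ => tendsto_regThauma hρ⟩
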